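/- **Theorem 3.** For a $2n\times 2n$ symmetric matrix $A=(a_{ij})$ let $\operatorname{haf}A=\sum_{M}\prod_{ij\in M}a_{ij}$ be its hafnian, where $M$ ranges over all partitions of $\{1,\dots,2n\}$ into $n$ pairs. Let $\mathcal S(n,N)$ be the set of all $2n\times 2n$ symmetric matrices with zero diagonal each of whose entries is a univariate polynomial with integer coefficients and degree at most $N$. There exist a bivariate polynomial $f$, a constant $C$ and an algorithm such that, for every integer $k\ge 1$, all $n,N\ge 0$ and every $A\in\mathcal S(n,N)$, the algorithm, given $n$, $N$, $k$ and $A$, computes the hafnian of $A$ modulo $2^k$ (that is, the residues modulo $2^k$ of the coefficients of $\operatorname{haf}A$ in degrees $0,\dots,nN$; the degree of $\operatorname{haf}A$ is at most $nN$) in at most $C\cdot f(n,N)^k$ steps. Here $f$, $C$ and the algorithm do not depend on $k$, $n$, $N$ or $A$. Time is measured at the level of single bits: an algorithm is a program in a first-order functional language over binary trees (nested pairs over one atom), in which each elementary operation (reading a variable, producing the atom, forming a pair, testing a tree and taking it apart, binding a variable, calling a function) costs one step. Matrices and polynomials are given as lists, $n$, $N$, $k$ as unary numbers, and each coefficient as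 its sign together with the list of the binary digits of its absolute value, least significant digit first. -/

import Mathlib

/-! ## Hafnians of polynomial matrices -/

namespace Haf

open Polynomial

/-- The partitions of a finite set `V` into (unordered) pairs: sets of two-element pairs such that
every element of `V` lies in exactly one of them. -/
def pairings (V : Type*) [Fintype V] [DecidableEq V] : Finset (Finset (Sym2 V)) :=
  Finset.univ.filter fun M => (∀ e ∈ M, ¬ e.IsDiag) ∧ ∀ v : V, (M.filter fun e => v ∈ e).card = 1

/-- The hafnian of a symmetric matrix: the sum over all partitions `M` of the index set into pairs
of the product of the entries `A i j` over the pairs `{i, j}` of `M`. The entry is read off above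
the diagonal, which for a symmetric matrix is no restriction. -/
def hafnian {V R : Type*} [Fintype V] [LinearOrder V] [CommSemiring R] (A : Matrix V V R) : R :=
  ∑ M ∈ pairings V, ∏ e ∈ M, A e.inf e.sup

/-- The `2n × 2n` symmetric matrices with zero diagonal each of whose entries is a univariate
polynomial (with integer coefficients) of degree at most `N`. -/
def polyMatrices (n N : ℕ) : Set (Matrix (Fin (2 * n)) (Fin (2 * n)) ℤ[X]) :=
  {A | A.IsSymm ∧ (∀ i, A i i = 0) ∧ ∀ i j, (A i j).natDegree ≤ N}

/-- Every partition of `2n` elements into pairs consists of `n` pairs. -/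
theorem card_of_mem_pairings {n : ℕ} {M : Finset (Sym2 (Fin (2 * n)))}
    (hM : M ∈ pairings (Fin (2 * n))) : M.card = n := by
  simp only [pairings, Finset.mem_filter, Finset.mem_univ, true_and] at hM
  obtain ⟨hd, hc⟩ := hM
  have hu : ∀ v, ∃! e, e ∈ M ∧ v ∈ e := fun v => by
    obtain ⟨e, he⟩ := Finset.card_eq_one.1 (hc v)
    have h : ∀ e', (e' ∈ M ∧ v ∈ e') ↔ e' = e := fun e' => by
      rw [← Finset.mem_singleton, ← he, Finset.mem_filter]
    exact ⟨e, (h e).2 rfl, fun e' h' => (h e').1 h'⟩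
  have h1 : (M.biUnion fun e => e.toFinset).card = ∑ e ∈ M, e.toFinset.card := by
    apply Finset.card_biUnion
    intro e he e' he' hne
    rw [Function.onFun, Finset.disjoint_left]
    intro v hv hv'
    rw [Sym2.mem_toFinset] at hv hv'
    exact hne ((hu v).unique ⟨he, hv⟩ ⟨he', hv'⟩)
  have h2 : (M.biUnion fun e => e.toFinset) = Finset.univ := by
    ext v
    obtain ⟨e, ⟨he, hv⟩, -⟩ := hu v
    simp only [Finset.mem_biUnion, Finset.mem_univ, iff_true]
    exact ⟨e, he, Sym2.mem_toFinset.2 hv⟩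
  have h3 : ∑ e ∈ M, e.toFinset.card = ∑ e ∈ M, 2 :=
    Finset.sum_congr rfl fun e he => Sym2.card_toFinset_of_not_isDiag e (hd e he)
  rw [h2, h3, Finset.card_univ, Fintype.card_fin, Finset.sum_const, smul_eq_mul] at h1
  omega

/-- The hafnian of a matrix in `polyMatrices n N` has degree at most `n * N`, hence it is determined
by its coefficients in degrees `0, …, n * N`. -/
theorem natDegree_hafnian_le {n N : ℕ} {A : Matrix (Fin (2 * n)) (Fin (2 * n)) ℤ[X]}
    (hA : A ∈ polyMatrices n N) : (hafnian A).natDegree ≤ n * N := by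
  refine natDegree_sum_le_of_forall_le (pairings (Fin (2 * n))) _ fun M hM => ?_
  refine (natDegree_prod_le _ _).trans ?_
  refine (Finset.sum_le_card_nsmul _ _ N fun e _ => hA.2.2 _ _).trans ?_
  rw [card_of_mem_pairings hM, smul_eq_mul]

end Haf

/-! ## Computation model

A pure first-order Lisp: the values are binary trees of cons cells over one atom `nil`, and a
program is a finite list of (mutually recursive) functions. Every elementary operation (reading a
variable, producing `nil`, allocating one cell, inspecting one cell, binding a variable, calling a
function) costs one step, and touches at most one cell. In particular there is no built-in
arithmetic and no built-in comparison of trees: numbers are lists of bits and have to be processed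
bit by bit. Every step is simulated by a bounded number of pointer operations, so the number of
steps agrees up to a polynomial with the running time on the usual (bit cost) models. -/

namespace Lisp

/-- Values: binary trees of cons cells. -/
inductive Val : Type
  | nil : Val
  | cons : Val → Val → Val

/-- Expressions. Variables are de Bruijn indices into the current environment. -/
inductive Expr : Type
  /-- the value of a variable -/
  | var (i : ℕ) : Expr
  /-- the atom -/
  | nil : Expr
  /-- a new cell -/
  | cons (a b : Expr) : Expr
  /-- `caseOf a b c`: evaluate `a`; if the value is `nil` continue with `b`; if it is a cell,
  continue with `c`, where variables `0` and `1` are the two components of the cell -/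
  | caseOf (a b c : Expr) : Expr
  /-- `letIn a b`: evaluate `a`, then evaluate `b`, where variable `0` is the value of `a` -/
  | letIn (a b : Expr) : Expr
  /-- `call f a`: apply function number `f` of the program to the value of `a` -/
  | call (f : ℕ) (a : Expr) : Expr

/-- A program: a finite list of function bodies, each an expression in one variable (variable `0`,
the argument). Function number `0` is the main function. -/
abbrev Program : Type := List Expr

/-- `Eval P env e v t`: in the program `P`, the evaluation of the expression `e` in the
environment `env` terminates with value `v` after exactly `t` steps (call by value). -/
inductive Eval (P : Program) : List Val → Expr → Val → ℕ → Prop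
  | var {env : List Val} {i : ℕ} {v : Val} :
      env[i]? = some v → Eval P env (.var i) v 1
  | nil {env : List Val} : Eval P env .nil .nil 1
  | cons {env : List Val} {a b : Expr} {u v : Val} {s t : ℕ} :
      Eval P env a u s → Eval P env b v t → Eval P env (.cons a b) (.cons u v) (s + t + 1)
  | case_nil {env : List Val} {a b c : Expr} {v : Val} {s t : ℕ} :
      Eval P env a .nil s → Eval P env b v t → Eval P env (.caseOf a b c) v (s + t + 1)
  | case_cons {env : List Val} {a b c : Expr} {x y v : Val} {s t : ℕ} :
      Eval P env a (.cons x y) s → Eval P (x :: y :: env) c v t →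
        Eval P env (.caseOf a b c) v (s + t + 1)
  | letIn {env : List Val} {a b : Expr} {u v : Val} {s t : ℕ} :
      Eval P env a u s → Eval P (u :: env) b v t → Eval P env (.letIn a b) v (s + t + 1)
  | call {env : List Val} {f : ℕ} {a body : Expr} {u v : Val} {s t : ℕ} :
      P[f]? = some body → Eval P env a u s → Eval P [u] body v t →
        Eval P env (.call f a) v (s + t + 1)

/-- The program `P`, started on the input `x`, halts with output `y` after exactly `t` steps. -/
def Halts (P : Program) (x y : Val) (t : ℕ) : Prop :=
  ∃ body, P[0]? = some body ∧ Eval P [x] body y t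

/-! ### Encodings -/

/-- A list, as a chain of cells ending in `nil`. -/
def encList (l : List Val) : Val := l.foldr .cons .nil

/-- A bit. -/
def encBool : Bool → Val
  | false => .nil
  | true => .cons .nil .nil

/-- A natural number in unary. -/
def encUnary (m : ℕ) : Val := encList (List.replicate m .nil)

/-- A natural number in binary: the list of its bits, least significant bit first, without
superfluous zeros. -/
def encNat (m : ℕ) : Val := encList (m.bits.map encBool)

/-- An integer: a cell consisting of the sign and of the absolute value in binary. -/
def encInt (z : ℤ) : Val := .cons (encBool (decide (z < 0))) (encNat z.natAbs)

/-- An integer polynomial of degree at most `d`: the list of its coefficients in degrees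
`0, …, d`. -/
def encPoly (d : ℕ) (p : Polynomial ℤ) : Val :=
  encList ((List.range (d + 1)).map fun i => encInt (p.coeff i))

/-- An integer polynomial of degree at most `d` modulo `m`: the list of the residues, in
`{0, …, m - 1}`, of its coefficients in degrees `0, …, d`. -/
def encPolyMod (m d : ℕ) (p : Polynomial ℤ) : Val :=
  encList ((List.range (d + 1)).map fun i => encNat (p.coeff i % (m : ℤ)).toNat)

/-- A matrix of integer polynomials of degree at most `d`: the list of its rows. -/
def encMatrix (d : ℕ) {m : ℕ} (A : Matrix (Fin m) (Fin m) (Polynomial ℤ)) : Val :=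
  encList (List.ofFn fun i => encList (List.ofFn fun j => encPoly d (A i j)))

/-- The input: the parameters `n`, `N`, `k` and a `2n × 2n` matrix of integer polynomials of degree
at most `N`. -/
def encInput (n N k : ℕ) (A : Matrix (Fin (2 * n)) (Fin (2 * n)) (Polynomial ℤ)) : Val :=
  .cons (encUnary n) (.cons (encUnary N) (.cons (encUnary k) (encMatrix N A)))

end Lisp

/-! The Pfaffian is the hafnian with a sign on each pairing, the parity of its crossings, and it is
computable in polynomial time. The signs are removed one possible crossing at a time. A crossing of
a pairing of `{0, …, K - 1}`, `K = 2n`, sits at an increasing quadruple `i < j < k < l` with `{i,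
k}` and `{j, l}` in the pairing, so there are at most `K ^ 4` places. Let `H_r(A)` be the signed sum
in which the first `r` places no longer count. Then `H_{r+1}(A) = H_r(A) - 2 H_r(A')`, where `A'` is
`A` with entries zeroed so that only pairings containing both crossing pairs survive
(`partialHafnian_succ`). Modulo `2 ^ b` the second term is needed only modulo `2 ^ (b - 1)`, so the
second branch is taken at most `b` times along a path and the recursion tree has at most `2 (r + 1)
^ b - 1` nodes. Its leaves are zero (`b = 0`) or Pfaffians (`r = 0`).

The Pfaffians have to be computed without division, since coefficients are only known modulo `2 ^
k`. The alternating matrix is deformed by `X` times the standard symplectic matrix `J`. The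
quasi-free functional `wick` on the exterior algebra yields a linear system for the cofactors
(`sum_mul_cofactor`). As `J` is a signed permutation matrix, comparing coefficients of `X ^ (d + 1)`
gives the cofactors in degree `d` from degree `d + 1` (`cofCoeff_rec`), starting above the degree
bound, where they vanish. Bordering by two rows at a time (`pfCoeff_rec`) builds the whole Pfaffian,
and its constant coefficient is the one sought.

For the running time, `Cmp` is uniform computability in time polynomial in a size measure; it is
closed under composition, case distinction and tree recursion (`tree`). The measure is `base ^ k`,
with `base` a polynomial in `n` and `N`. It dominates `2 ^ k`, so residues can be kept in unary, and
a fixed power of it has the required form `f ^ k`. -/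

namespace Lisp

/-! ### Polynomially bounded functions -/

/-- `f` is bounded by a polynomial in `s`. -/
def PolyBounded {ι : Type*} (f s : ι → ℕ) : Prop := ∃ c, ∀ i, f i ≤ (s i + c) ^ c

theorem add_pow_self_mono {a b c d : ℕ} (h : a ≤ b) (h' : c ≤ d) : (a + c) ^ c ≤ (b + d) ^ d := by
  rcases Nat.eq_zero_or_pos d with rfl | hd
  · obtain rfl : c = 0 := by omega
    simp
  · calc (a + c) ^ c ≤ (b + d) ^ c := Nat.pow_le_pow_left (by omega) _
      _ ≤ (b + d) ^ d := Nat.pow_le_pow_right (by omega) h'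

namespace PolyBounded

variable {ι κ : Type*} {f g s : ι → ℕ}

theorem mono (hg : PolyBounded g s) (h : ∀ i, f i ≤ g i) : PolyBounded f s := by
  obtain ⟨c, hc⟩ := hg
  exact ⟨c, fun i => (h i).trans (hc i)⟩

theorem self : PolyBounded s s := ⟨1, fun i => by simp⟩

theorem of_le (h : ∀ i, f i ≤ s i) : PolyBounded f s := self.mono h

theorem const (a : ℕ) : PolyBounded (fun _ : ι => a) s :=
  ⟨a + 1, fun i => by
    calc a ≤ (s i + (a + 1)) ^ 1 := by rw [pow_one]; omega
      _ ≤ (s i + (a + 1)) ^ (a + 1) := Nat.pow_le_pow_right (by omega) (by omega)⟩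

theorem mul (hf : PolyBounded f s) (hg : PolyBounded g s) : PolyBounded (fun i => f i * g i) s := by
  obtain ⟨c, hc⟩ := hf
  obtain ⟨d, hd⟩ := hg
  refine ⟨c + d, fun i => ?_⟩
  rw [pow_add]
  exact Nat.mul_le_mul ((hc i).trans (Nat.pow_le_pow_left (by omega) _))
    ((hd i).trans (Nat.pow_le_pow_left (by omega) _))

/-- The exponent is raised by one more than the maximum would need, because a further factor `s i +
c + d + 2 ≥ 2` absorbs the sum of two equal bounds. -/
theorem add (hf : PolyBounded f s) (hg : PolyBounded g s) : PolyBounded (fun i => f i + g i) s := by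
  obtain ⟨c, hc⟩ := hf
  obtain ⟨d, hd⟩ := hg
  refine ⟨c + d + 2, fun i => ?_⟩
  have h1 := (hc i).trans (add_pow_self_mono (le_refl (s i)) (show c ≤ c + d + 1 by omega))
  have h2 := (hd i).trans (add_pow_self_mono (le_refl (s i)) (show d ≤ c + d + 1 by omega))
  have h3 : (s i + (c + d + 1)) ^ (c + d + 1) ≤ (s i + (c + d + 2)) ^ (c + d + 1) :=
    Nat.pow_le_pow_left (by omega) _
  rw [pow_succ]
  have h4 : 2 ≤ s i + (c + d + 2) := by omega
  nlinarith [Nat.mul_le_mul_left ((s i + (c + d + 2)) ^ (c + d + 1)) h4]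

theorem comp (hf : PolyBounded f s) (φ : κ → ι) :
    PolyBounded (fun p => f (φ p)) (fun p => s (φ p)) := by
  obtain ⟨c, hc⟩ := hf
  exact ⟨c, fun p => hc (φ p)⟩

theorem pow (hf : PolyBounded f s) (d : ℕ) : PolyBounded (fun i => f i ^ d) s := by
  induction d with
  | zero => exact const 1
  | succ d ih => simpa only [pow_succ] using ih.mul hf

end PolyBounded

/-! ### Relocation of programs -/

/-- Renumbering of the functions called by an expression. -/
def Expr.shift (d : ℕ) : Expr → Expr
  | .var i => .var i
  | .nil => .nil
  | .cons a b => .cons (a.shift d) (b.shift d)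
  | .caseOf a b c => .caseOf (a.shift d) (b.shift d) (c.shift d)
  | .letIn a b => .letIn (a.shift d) (b.shift d)
  | .call f a => .call (d + f) (a.shift d)

/-- Function numbers are absolute, so code added at the end disturbs nothing, while code added in
front (`Eval.prepend`) requires renumbering. With both, independently given programs can be linked
into one. -/
theorem Eval.append {P : Program} {env : List Val} {e : Expr} {v : Val} {t : ℕ}
    (h : Eval P env e v t) (Q : Program) : Eval (P ++ Q) env e v t := by
  induction h with
  | var h => exact .var h
  | nil => exact .nil
  | cons _ _ h₁ h₂ => exact .cons h₁ h₂
  | case_nil _ _ h₁ h₂ => exact .case_nil h₁ h₂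
  | case_cons _ _ h₁ h₂ => exact .case_cons h₁ h₂
  | letIn _ _ h₁ h₂ => exact .letIn h₁ h₂
  | call h _ _ h₁ h₂ =>
    refine .call ?_ h₁ h₂
    rw [List.getElem?_append_left (List.getElem?_eq_some_iff.1 h).1, h]

theorem Eval.prepend {P : Program} {env : List Val} {e : Expr} {v : Val} {t : ℕ}
    (h : Eval P env e v t) (Q : Program) :
    Eval (Q ++ P.map (Expr.shift Q.length)) env (e.shift Q.length) v t := by
  induction h with
  | var h => exact .var h
  | nil => exact .nil
  | cons _ _ h₁ h₂ => exact .cons h₁ h₂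
  | case_nil _ _ h₁ h₂ => exact .case_nil h₁ h₂
  | case_cons _ _ h₁ h₂ => exact .case_cons h₁ h₂
  | letIn _ _ h₁ h₂ => exact .letIn h₁ h₂
  | call h _ _ h₁ h₂ =>
    refine .call ?_ h₁ h₂
    rw [List.getElem?_append_right (by omega), Nat.add_sub_cancel_left, List.getElem?_map, h,
      Option.map_some]

/-- Function number `f` of the program `P` maps `x` to `y` in exactly `t` steps. -/
def Runs (P : Program) (f : ℕ) (x y : Val) (t : ℕ) : Prop :=
  ∃ body, P[f]? = some body ∧ Eval P [x] body y t

theorem Runs.append {P : Program} {f : ℕ} {x y : Val} {t : ℕ} (h : Runs P f x y t) (Q : Program) :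
    Runs (P ++ Q) f x y t := by
  obtain ⟨b, hb, h⟩ := h
  refine ⟨b, ?_, h.append Q⟩
  rw [List.getElem?_append_left (List.getElem?_eq_some_iff.1 hb).1, hb]

theorem Runs.prepend {P : Program} {f : ℕ} {x y : Val} {t : ℕ} (h : Runs P f x y t) (Q : Program) :
    Runs (Q ++ P.map (Expr.shift Q.length)) (Q.length + f) x y t := by
  obtain ⟨b, hb, h⟩ := h
  refine ⟨b.shift Q.length, ?_, h.prepend Q⟩
  rw [List.getElem?_append_right (by omega), Nat.add_sub_cancel_left, List.getElem?_map, hb,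
    Option.map_some]

theorem Runs.call {P : Program} {f : ℕ} {x y : Val} {s t : ℕ} {env : List Val} {a : Expr}
    (h : Runs P f x y t) (ha : Eval P env a x s) : Eval P env (.call f a) y (s + t + 1) := by
  obtain ⟨b, hb, h⟩ := h
  exact .call hb ha h

/-! ### Uniform polynomial time computability -/

/-- Function number `f` of the program `P` maps `x i` to `y i` for all `i`, in a number of steps
that is bounded by a polynomial in `s i`. -/
def RunsIn {ι : Type} (P : Program) (f : ℕ) (s : ι → ℕ) (x y : ι → Val) : Prop :=
  ∃ T : ι → ℕ, PolyBounded T s ∧ ∀ i, ∃ t ≤ T i, Runs P f (x i) (y i) t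

/-- Some program computes `y i` from `x i` for all `i`, in a number of steps that is bounded by a
polynomial in `s i`. -/
def Cmp {ι : Type} (s : ι → ℕ) (x y : ι → Val) : Prop := ∃ P f, RunsIn P f s x y

theorem RunsIn.append {ι : Type} {P : Program} {f : ℕ} {s : ι → ℕ} {x y : ι → Val}
    (h : RunsIn P f s x y) (Q : Program) : RunsIn (P ++ Q) f s x y := by
  obtain ⟨T, hT, h⟩ := h
  refine ⟨T, hT, fun i => ?_⟩
  obtain ⟨t, ht, h⟩ := h i
  exact ⟨t, ht, h.append Q⟩

namespace Cmp

variable {ι κ : Type} {s : ι → ℕ} {x y z : ι → Val}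

theorem link (h : Cmp s x y) (P : Program) : ∃ Q f, RunsIn (P ++ Q) f s x y := by
  obtain ⟨Q, f, T, hT, h⟩ := h
  refine ⟨Q.map (Expr.shift P.length), P.length + f, T, hT, fun i => ?_⟩
  obtain ⟨t, ht, h⟩ := h i
  exact ⟨t, ht, h.prepend P⟩

theorem of_eval (P : Program) (e : Expr) {T : ι → ℕ} (hT : PolyBounded T s)
    (h : ∀ i, ∃ t ≤ T i, Eval P [x i] e (y i) t) : Cmp s x y := by
  refine ⟨P ++ [e], P.length, T, hT, fun i => ?_⟩
  obtain ⟨t, ht, h⟩ := h i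
  exact ⟨t, ht, e, by simp, h.append _⟩

/-- The program does not see the index. Reindexing restricts a family to the instances where it is
needed, or adds parameters such as a loop counter. -/
theorem reindex (h : Cmp s x y) (φ : κ → ι) :
    Cmp (fun p => s (φ p)) (fun p => x (φ p)) (fun p => y (φ p)) := by
  obtain ⟨P, f, T, hT, h⟩ := h
  exact ⟨P, f, _, hT.comp φ, fun p => h (φ p)⟩

theorem congr {y' : ι → Val} (h : Cmp s x y) (hy : ∀ i, y i = y' i) : Cmp s x y' := by
  rwa [← funext hy]

theorem id : Cmp s x x := of_eval [] (.var 0) (.const 1) fun _ => ⟨1, le_rfl, .var rfl⟩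

theorem comp (h : Cmp s x y) (h' : Cmp s y z) : Cmp s x z := by
  obtain ⟨P, f, hP⟩ := h
  obtain ⟨Q, g, T', hT', h'⟩ := h'.link P
  obtain ⟨T, hT, h⟩ := hP.append Q
  refine of_eval (P ++ Q) (.call g (.call f (.var 0))) ((hT.add hT').add (.const 3)) fun i => ?_
  obtain ⟨t, ht, h⟩ := h i
  obtain ⟨t', ht', h'⟩ := h' i
  exact ⟨_, by omega, h'.call (h.call (.var rfl))⟩

theorem cons (h : Cmp s x y) (h' : Cmp s x z) : Cmp s x (fun i => .cons (y i) (z i)) := by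
  obtain ⟨P, f, hP⟩ := h
  obtain ⟨Q, g, T', hT', h'⟩ := h'.link P
  obtain ⟨T, hT, h⟩ := hP.append Q
  refine of_eval (P ++ Q) (.cons (.call f (.var 0)) (.call g (.var 0)))
    ((hT.add hT').add (.const 5)) fun i => ?_
  obtain ⟨t, ht, h⟩ := h i
  obtain ⟨t', ht', h'⟩ := h' i
  exact ⟨_, by omega, .cons (h.call (.var rfl)) (h'.call (.var rfl))⟩

theorem nil : Cmp s x (fun _ => .nil) :=
  of_eval [] .nil (.const 1) fun _ => ⟨1, le_rfl, .nil⟩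

theorem const (v : Val) : Cmp s x (fun _ => v) := by
  induction v with
  | nil => exact nil
  | cons a b ha hb => exact ha.cons hb

end Cmp

/-- The first component of a cell. -/
def Val.hd : Val → Val
  | .nil => .nil
  | .cons a _ => a

/-- The second component of a cell. -/
def Val.tl : Val → Val
  | .nil => .nil
  | .cons _ b => b

namespace Cmp

variable {ι κ : Type} {s : ι → ℕ} {x y z : ι → Val}

theorem hd (h : Cmp s x y) : Cmp s x (fun i => (y i).hd) := by
  refine h.comp (of_eval [] (.caseOf (.var 0) .nil (.var 0)) (.const 3) fun i => ?_)
  cases hy : y i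
  · exact ⟨3, le_rfl, .case_nil (.var rfl) .nil⟩
  · exact ⟨3, le_rfl, .case_cons (.var rfl) (.var rfl)⟩

theorem tl (h : Cmp s x y) : Cmp s x (fun i => (y i).tl) := by
  refine h.comp (of_eval [] (.caseOf (.var 0) .nil (.var 1)) (.const 3) fun i => ?_)
  cases hy : y i
  · exact ⟨3, le_rfl, .case_nil (.var rfl) .nil⟩
  · exact ⟨3, le_rfl, .case_cons (.var rfl) (.var rfl)⟩

theorem fst {a b : ι → Val} (h : Cmp s x (fun i => .cons (a i) (b i))) : Cmp s x a := h.hd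
theorem snd {a b : ι → Val} (h : Cmp s x (fun i => .cons (a i) (b i))) : Cmp s x b := h.tl

/-- What is computable from `x` is computable from a pair with first component `x`. -/
theorem up (h : Cmp s x y) (φ : κ → ι) (w : κ → Val) :
    Cmp (fun p => s (φ p)) (fun p => .cons (x (φ p)) (w p)) (fun p => y (φ p)) :=
  (fst id).comp (h.reindex φ)

theorem last {w : ι → Val} : Cmp s (fun i => .cons (x i) (w i)) w := snd id

/-- Case distinction; each branch has to be computable only where it is used. -/
theorem ite_of {p : ι → Prop} [DecidablePred p] (hp : Cmp s x (fun i => encBool (decide (p i))))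
    (hy : Cmp (fun i : {i // p i} => s i) (fun i => x i) (fun i => y i))
    (hz : Cmp (fun i : {i // ¬ p i} => s i) (fun i => x i) (fun i => z i)) :
    Cmp s x (fun i => if p i then y i else z i) := by
  obtain ⟨P, f, hP⟩ := hp
  obtain ⟨Q, g, hQ⟩ := hy.link P
  obtain ⟨R, k, T₂, ⟨c₂, hc₂⟩, h₂⟩ := hz.link (P ++ Q)
  obtain ⟨T₀, hT₀, h₀⟩ := (hP.append Q).append R
  obtain ⟨T₁, ⟨c₁, hc₁⟩, h₁⟩ := hQ.append R
  -- In the cell branch the argument is variable `2`, below the two components bound by `caseOf`; in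
  -- the `nil` branch it is still variable `0`.
  refine of_eval (P ++ Q ++ R) (.caseOf (.call f (.var 0)) (.call k (.var 0)) (.call g (.var 2)))
    (T := fun i => T₀ i + (s i + c₁) ^ c₁ + (s i + c₂) ^ c₂ + 5)
    (((hT₀.add ⟨c₁, fun _ => le_rfl⟩).add ⟨c₂, fun _ => le_rfl⟩).add (.const 5)) fun i => ?_
  obtain ⟨t₀, ht₀, h₀⟩ := h₀ i
  by_cases hi : p i
  · obtain ⟨t₁, ht₁, h₁⟩ := h₁ ⟨i, hi⟩
    have := hc₁ ⟨i, hi⟩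
    simp only [hi, decide_true, encBool] at h₀
    rw [if_pos hi]
    refine ⟨_, ?_, .case_cons (h₀.call (.var rfl)) (h₁.call (.var rfl))⟩
    simp only at this
    omega
  · obtain ⟨t₂, ht₂, h₂⟩ := h₂ ⟨i, hi⟩
    have := hc₂ ⟨i, hi⟩
    simp only [hi, decide_false, encBool] at h₀
    rw [if_neg hi]
    refine ⟨_, ?_, .case_nil (h₀.call (.var rfl)) (h₂.call (.var rfl))⟩
    simp only at this
    omega

theorem ite {p : ι → Prop} [DecidablePred p] (hp : Cmp s x (fun i => encBool (decide (p i))))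
    (hy : Cmp s x y) (hz : Cmp s x z) : Cmp s x (fun i => if p i then y i else z i) :=
  ite_of hp (hy.reindex _) (hz.reindex _)

/-- Recursion over a binary tree whose number of nodes is polynomially bounded: the nodes are the
indices `i`, the children of the node `i`, unless it is a leaf, are `φ i` and `ψ i`. -/
theorem tree {leaf : ι → Prop} [DecidablePred leaf] {φ ψ : ι → ι} {cnt : ι → ℕ}
    (hl : Cmp s x (fun i => encBool (decide (leaf i))))
    (h₀ : Cmp (fun i : {i // leaf i} => s i) (fun i => x i) (fun i => y i))
    (hφ : Cmp (fun i : {i // ¬ leaf i} => s i) (fun i => x i) (fun i => x (φ i)))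
    (hψ : Cmp (fun i : {i // ¬ leaf i} => s i) (fun i => x i) (fun i => x (ψ i)))
    (h₁ : Cmp (fun i : {i // ¬ leaf i} => s i)
      (fun i => .cons (x i) (.cons (y (φ i)) (y (ψ i)))) (fun i => y i))
    (hsφ : ∀ i, ¬ leaf i → s (φ i) ≤ s i) (hsψ : ∀ i, ¬ leaf i → s (ψ i) ≤ s i)
    (hcnt : ∀ i, ¬ leaf i → 1 + cnt (φ i) + cnt (ψ i) ≤ cnt i) (hpos : ∀ i, 1 ≤ cnt i)
    (hb : PolyBounded cnt s) : Cmp s x y := by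
  obtain ⟨P₁, f₁, h1⟩ := hl
  obtain ⟨P₂, f₂, h2⟩ := h₀.link P₁
  obtain ⟨P₃, f₃, h3⟩ := hφ.link (P₁ ++ P₂)
  obtain ⟨P₄, f₄, h4⟩ := hψ.link (P₁ ++ P₂ ++ P₃)
  obtain ⟨P₅, f₅, h5⟩ := h₁.link (P₁ ++ P₂ ++ P₃ ++ P₄)
  replace h1 := (((h1.append P₂).append P₃).append P₄).append P₅
  replace h2 := ((h2.append P₃).append P₄).append P₅
  replace h3 := (h3.append P₄).append P₅
  replace h4 := h4.append P₅
  generalize P₁ ++ P₂ ++ P₃ ++ P₄ ++ P₅ = R at h1 h2 h3 h4 h5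
  -- `e` becomes function number `R.length`, so the calls with that number are the recursive ones.
  let e : Expr := .caseOf (.call f₁ (.var 0))
    (.call f₅ (.cons (.var 0) (.cons (.call R.length (.call f₃ (.var 0)))
      (.call R.length (.call f₄ (.var 0))))))
    (.call f₂ (.var 2))
  obtain ⟨T₁, ⟨c₁, hc₁⟩, h1⟩ := h1.append [e]
  obtain ⟨T₂, ⟨c₂, hc₂⟩, h2⟩ := h2.append [e]
  obtain ⟨T₃, ⟨c₃, hc₃⟩, h3⟩ := h3.append [e]
  obtain ⟨T₄, ⟨c₄, hc₄⟩, h4⟩ := h4.append [e]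
  obtain ⟨T₅, ⟨c₅, hc₅⟩, h5⟩ := h5.append [e]
  -- `K` bounds the work at one node apart from the recursive calls. Being monotone, it bounds by `K
  -- (s i)` the work at every node below `i`, so the total is at most `cnt i * K (s i)`.
  let K : ℕ → ℕ := fun a => (a + c₁) ^ c₁ + (a + c₂) ^ c₂ + (a + c₃) ^ c₃ + (a + c₄) ^ c₄ +
    (a + c₅) ^ c₅ + 20
  have hK : Monotone K := fun a b h => by
    have h' : ∀ c, (a + c) ^ c ≤ (b + c) ^ c := fun c => add_pow_self_mono h le_rfl
    simp only [K]
    linarith [h' c₁, h' c₂, h' c₃, h' c₄, h' c₅]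
  have he : (R ++ [e])[R.length]? = some e := by simp
  refine ⟨R ++ [e], R.length, fun i => cnt i * K (s i), hb.mul ?_, ?_⟩
  · exact ((((PolyBounded.add ⟨c₁, fun _ => le_rfl⟩ ⟨c₂, fun _ => le_rfl⟩).add
      ⟨c₃, fun _ => le_rfl⟩).add ⟨c₄, fun _ => le_rfl⟩).add ⟨c₅, fun _ => le_rfl⟩).add (.const 20)
  intro i
  induction hn : cnt i using Nat.strong_induction_on generalizing i with
  | _ n ih =>
    subst hn
    obtain ⟨t₁, ht₁, r₁⟩ := h1 i
    have b₁ := ht₁.trans (hc₁ i)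
    by_cases hi : leaf i
    · obtain ⟨t₂, ht₂, r₂⟩ := h2 ⟨i, hi⟩
      have b₂ := ht₂.trans (hc₂ ⟨i, hi⟩)
      simp only [hi, decide_true, encBool] at r₁
      refine ⟨_, ?_, e, he, .case_cons (r₁.call (.var rfl)) (r₂.call (.var rfl))⟩
      refine le_trans ?_ (Nat.mul_le_mul_right _ (hpos i))
      simp only [K] at b₂ ⊢
      omega
    · obtain ⟨t₃, ht₃, r₃⟩ := h3 ⟨i, hi⟩
      obtain ⟨t₄, ht₄, r₄⟩ := h4 ⟨i, hi⟩
      obtain ⟨t₅, ht₅, r₅⟩ := h5 ⟨i, hi⟩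
      have b₃ := ht₃.trans (hc₃ ⟨i, hi⟩)
      have b₄ := ht₄.trans (hc₄ ⟨i, hi⟩)
      have b₅ := ht₅.trans (hc₅ ⟨i, hi⟩)
      have hc := hcnt i hi
      obtain ⟨u, hu, ru⟩ := ih (cnt (φ i)) (by omega) (φ i) rfl
      obtain ⟨v, hv, rv⟩ := ih (cnt (ψ i)) (by omega) (ψ i) rfl
      simp only [hi, decide_false, encBool] at r₁
      refine ⟨_, ?_, e, he, .case_nil (r₁.call (.var rfl)) (r₅.call (.cons (.var rfl)
        (.cons (ru.call (r₃.call (.var rfl))) (rv.call (r₄.call (.var rfl))))))⟩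
      have hu' := hu.trans (Nat.mul_le_mul_left _ (hK (hsφ i hi)))
      have hv' := hv.trans (Nat.mul_le_mul_left _ (hK (hsψ i hi)))
      refine le_trans ?_ (Nat.mul_le_mul_right (K (s i)) hc)
      have : t₁ + t₃ + t₄ + t₅ + 20 ≤ K (s i) := by
        simp only [K] at b₃ b₄ b₅ ⊢
        omega
      rw [add_mul, add_mul, one_mul]
      omega

end Cmp

end Lisp

/-! ### Unary arithmetic, logic and lists -/

namespace Lisp

theorem encUnary_succ (m : ℕ) : encUnary (m + 1) = .cons .nil (encUnary m) := rfl

theorem encUnary_eq_nil {m : ℕ} : encUnary m = .nil ↔ m = 0 := by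
  cases m
  · simp [encUnary, encList]
  · simp [encUnary_succ]

theorem tl_encUnary (m : ℕ) : (encUnary m).tl = encUnary (m - 1) := by
  cases m <;> rfl

theorem tl_encList (l : List Val) : (encList l).tl = encList l.tail := by
  cases l <;> rfl

theorem hd_encList (l : List Val) : (encList l).hd = l.getD 0 .nil := by
  cases l <;> rfl

namespace Cmp

variable {ι κ : Type} {s : ι → ℕ} {x y z : ι → Val}

theorem isNil (h : Cmp s x y) {p : ι → Prop} [DecidablePred p] (hp : ∀ i, p i ↔ y i = .nil) :
    Cmp s x (fun i => encBool (decide (p i))) := by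
  refine h.comp (of_eval [] (.caseOf (.var 0) (.cons .nil .nil) .nil) (.const 5) fun i => ?_)
  cases hy : y i
  · rw [decide_eq_true ((hp i).2 hy)]
    exact ⟨5, le_rfl, .case_nil (.var rfl) (.cons .nil .nil)⟩
  · rw [decide_eq_false (by rw [hp, hy]; simp)]
    exact ⟨3, by norm_num, .case_cons (.var rfl) .nil⟩

/-! #### Logical connectives -/

theorem and {p q : ι → Prop} [DecidablePred p] [DecidablePred q]
    (hp : Cmp s x (fun i => encBool (decide (p i))))
    (hq : Cmp s x (fun i => encBool (decide (q i)))) :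
    Cmp s x (fun i => encBool (decide (p i ∧ q i))) :=
  (ite hp hq nil).congr fun i => by by_cases h : p i <;> simp [h, encBool]

theorem not {p : ι → Prop} [DecidablePred p] (hp : Cmp s x (fun i => encBool (decide (p i)))) :
    Cmp s x (fun i => encBool (decide (¬ p i))) :=
  (ite hp nil (const (encBool true))).congr fun i => by by_cases h : p i <;> simp [h, encBool]

theorem or {p q : ι → Prop} [DecidablePred p] [DecidablePred q]
    (hp : Cmp s x (fun i => encBool (decide (p i))))
    (hq : Cmp s x (fun i => encBool (decide (q i)))) :
    Cmp s x (fun i => encBool (decide (p i ∨ q i))) :=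
  (ite hp (const (encBool true)) hq).congr fun i => by by_cases h : p i <;> simp [h]

/-! #### Primitive recursion -/

/-- Primitive recursion along a polynomially bounded unary number. -/
theorem natrec {n : ι → ℕ} {σ : ι → ℕ → Val} (hn : Cmp s x (fun i => encUnary (n i)))
    (hb : PolyBounded n s) (h₀ : Cmp s x (fun i => σ i 0))
    (hs : Cmp (fun p : Σ i, Fin (n i) => s p.1)
      (fun p => .cons (x p.1) (.cons (encUnary p.2) (σ p.1 p.2))) (fun p => σ p.1 (p.2 + 1))) :
    Cmp s x (fun i => σ i (n i)) := by
  let κ := Σ i, Fin (n i + 1)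
  have key : Cmp (fun p : κ => s p.1) (fun p => .cons (x p.1) (encUnary p.2))
      (fun p => σ p.1 p.2) := by
    -- A loop is a tree in which every inner node has a dummy leaf as second child, whence `2 j + 1`
    -- nodes at stage `j`.
    refine tree (leaf := fun p => (p.2 : ℕ) = 0)
      (φ := fun p => ⟨p.1, p.2 - 1, (Nat.sub_le _ _).trans_lt p.2.2⟩)
      (ψ := fun p => ⟨p.1, 0⟩) (cnt := fun p => 2 * p.2 + 1)
      ((snd id).isNil fun p => encUnary_eq_nil.symm) ?_ ?_ ?_ ?_ (fun p _ => le_rfl)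
      (fun p _ => le_rfl) ?_ ?_ ?_
    · refine ((h₀.up (fun p : {p : κ // (p.2 : ℕ) = 0} => p.1.1) fun p => encUnary p.1.2)).congr ?_
      rintro ⟨p, hp⟩
      simp only [hp]
    · exact ((fst id).cons (snd id).tl).congr fun p => by rw [tl_encUnary]
    · exact ((fst id).cons nil).congr fun p => rfl
    · have h1 : Cmp (fun p : {p : κ // ¬ (p.2 : ℕ) = 0} => s p.1.1)
          (fun p => .cons (.cons (x p.1.1) (encUnary p.1.2))
            (.cons (σ p.1.1 (p.1.2 - 1)) (σ p.1.1 0)))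
          (fun p => .cons (x p.1.1) (.cons (encUnary (p.1.2 - 1)) (σ p.1.1 (p.1.2 - 1)))) :=
        ((fst (fst id)).cons ((snd (fst id)).tl.cons (fst (snd id)))).congr fun p => by
          rw [tl_encUnary]
      refine (h1.comp (hs.reindex fun p : {p : κ // ¬ (p.2 : ℕ) = 0} =>
        ⟨p.1.1, ⟨p.1.2 - 1, by have := p.1.2.2; have := p.2; omega⟩⟩)).congr fun p => ?_
      have := p.2
      simp only [Nat.sub_add_cancel (Nat.one_le_iff_ne_zero.2 this)]
    · intro p hp
      simp only [Fin.val_zero] at hp ⊢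
      omega
    · intro p
      omega
    · refine (((PolyBounded.const 2).mul (hb.comp fun p : κ => p.1)).add (.const 1)).mono
        fun p => ?_
      have := p.2.2
      omega
  exact (id.cons hn).comp (key.reindex fun i => ⟨i, ⟨n i, Nat.lt_succ_self _⟩⟩)

/-! #### Unary arithmetic -/

theorem succ {a : ι → ℕ} (h : Cmp s x (fun i => encUnary (a i))) :
    Cmp s x (fun i => encUnary (a i + 1)) := nil.cons h

theorem pred {a : ι → ℕ} (h : Cmp s x (fun i => encUnary (a i))) :
    Cmp s x (fun i => encUnary (a i - 1)) := h.tl.congr fun _ => tl_encUnary _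

theorem add {a b : ι → ℕ} (ha : Cmp s x (fun i => encUnary (a i)))
    (hb : Cmp s x (fun i => encUnary (b i))) (hb' : PolyBounded b s) :
    Cmp s x (fun i => encUnary (a i + b i)) :=
  natrec (σ := fun i j => encUnary (a i + j)) hb hb' ha (succ (snd (snd id)))

theorem sub {a b : ι → ℕ} (ha : Cmp s x (fun i => encUnary (a i)))
    (hb : Cmp s x (fun i => encUnary (b i))) (hb' : PolyBounded b s) :
    Cmp s x (fun i => encUnary (a i - b i)) :=
  natrec (σ := fun i j => encUnary (a i - j)) hb hb' ha (pred (snd (snd id)))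

theorem mul {a b : ι → ℕ} (ha : Cmp s x (fun i => encUnary (a i))) (ha' : PolyBounded a s)
    (hb : Cmp s x (fun i => encUnary (b i))) (hb' : PolyBounded b s) :
    Cmp s x (fun i => encUnary (a i * b i)) :=
  natrec (σ := fun i j => encUnary (a i * j)) hb hb' nil
    (add (a := fun p : Σ i, Fin (b i) => a p.1 * p.2) (snd (snd id)) (ha.up _ _) (ha'.comp _))

theorem lt {a b : ι → ℕ} (ha : Cmp s x (fun i => encUnary (a i)))
    (hb : Cmp s x (fun i => encUnary (b i))) (hb' : PolyBounded b s) :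
    Cmp s x (fun i => encBool (decide (a i < b i))) :=
  (sub ha.succ hb hb').isNil fun i => by rw [encUnary_eq_nil]; omega

theorem eq {a b : ι → ℕ} (ha : Cmp s x (fun i => encUnary (a i))) (ha' : PolyBounded a s)
    (hb : Cmp s x (fun i => encUnary (b i))) (hb' : PolyBounded b s) :
    Cmp s x (fun i => encBool (decide (a i = b i))) :=
  (add (sub ha hb hb') (sub hb ha ha') (hb'.mono fun _ => Nat.sub_le _ _)).isNil
    fun i => by rw [encUnary_eq_nil]; omega

theorem eq_zero {a : ι → ℕ} (ha : Cmp s x (fun i => encUnary (a i))) :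
    Cmp s x (fun i => encBool (decide (a i = 0))) :=
  ha.isNil fun _ => encUnary_eq_nil.symm

theorem unary (a : ℕ) : Cmp s x (fun _ => encUnary a) := const _

theorem iteNat {a b : ι → ℕ} {p : ι → Prop} [DecidablePred p]
    (hp : Cmp s x (fun i => encBool (decide (p i)))) (ha : Cmp s x (fun i => encUnary (a i)))
    (hb : Cmp s x (fun i => encUnary (b i))) :
    Cmp s x (fun i => encUnary (if p i then a i else b i)) :=
  (ite hp ha hb).congr fun i => by split <;> rfl

theorem mod {a m : ι → ℕ} (ha : Cmp s x (fun i => encUnary (a i))) (ha' : PolyBounded a s)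
    (hm : Cmp s x (fun i => encUnary (m i))) (hm' : PolyBounded m s) :
    Cmp s x (fun i => encUnary (a i % m i)) := by
  refine natrec (σ := fun i j => encUnary (j % m i)) ha ha' ((unary 0).congr fun i => by simp) ?_
  have hj : Cmp (fun p : Σ i, Fin (a i) => s p.1)
      (fun p => .cons (x p.1) (.cons (encUnary p.2) (encUnary (p.2 % m p.1))))
      (fun p => encUnary (p.2 % m p.1 + 1)) := succ (snd (snd id))
  refine (iteNat (eq hj ?_ (hm.up _ _) (hm'.comp _)) (unary 0) hj).congr fun p => ?_
  · refine ((ha'.comp _).add (.const 1)).mono fun p => ?_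
    have := Nat.mod_le (p.2 : ℕ) (m p.1)
    have := p.2.2
    omega
  · congr 1
    -- For modulus `0` the counter is `j % 0 = j`, and the reset never occurs.
    rcases Nat.eq_zero_or_pos (m p.1) with h | h
    · simp [h]
    · have := Nat.mod_lt (p.2 : ℕ) h
      rw [← Nat.mod_add_mod (p.2 : ℕ)]
      split_ifs with h'
      · rw [h', Nat.mod_self]
      · exact (Nat.mod_eq_of_lt (by omega)).symm

theorem div {a m : ι → ℕ} (ha : Cmp s x (fun i => encUnary (a i))) (ha' : PolyBounded a s)
    (hm : Cmp s x (fun i => encUnary (m i))) (hm' : PolyBounded m s) :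
    Cmp s x (fun i => encUnary (a i / m i)) := by
  refine natrec (σ := fun i j => encUnary (j / m i)) ha ha' ((unary 0).congr fun i => by simp) ?_
  have hj : Cmp (fun p : Σ i, Fin (a i) => s p.1)
      (fun p => .cons (x p.1) (.cons (encUnary p.2) (encUnary (p.2 / m p.1))))
      (fun p => encUnary (p.2 + 1)) := succ (fst (snd id))
  have hq : Cmp (fun p : Σ i, Fin (a i) => s p.1)
      (fun p => .cons (x p.1) (.cons (encUnary p.2) (encUnary (p.2 / m p.1))))
      (fun p => encUnary (p.2 / m p.1)) := snd (snd id)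
  refine (iteNat (eq_zero (mod hj ?_ (hm.up _ _) (hm'.comp _))) hq.succ hq).congr fun p => ?_
  · exact (ha'.comp _).mono fun p => p.2.2
  · congr 1
    rw [Nat.succ_div]
    simp only [Nat.dvd_iff_mod_eq_zero]
    split_ifs <;> rfl

theorem two_pow {a : ι → ℕ} (ha : Cmp s x (fun i => encUnary (a i)))
    (ha' : PolyBounded (fun i => 2 ^ a i) s) : Cmp s x (fun i => encUnary (2 ^ a i)) := by
  refine natrec (σ := fun i j => encUnary (2 ^ j)) ha (ha'.mono fun i => Nat.lt_two_pow_self.le)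
    (unary 1) ?_
  refine (add (snd (snd id)) (snd (snd id)) ?_).congr fun p => by rw [pow_succ, mul_two]
  exact (ha'.comp _).mono fun p => Nat.pow_le_pow_right two_pos p.2.2.le

/-! #### Lists -/

theorem getD {l : ι → List Val} {j : ι → ℕ} (hl : Cmp s x (fun i => encList (l i)))
    (hj : Cmp s x (fun i => encUnary (j i))) (hj' : PolyBounded j s) :
    Cmp s x (fun i => (l i).getD (j i) .nil) := by
  have := natrec (σ := fun i j => encList ((l i).drop j)) hj hj' (hl.congr fun _ => rfl)
    ((snd (snd id)).tl.congr fun p => by rw [tl_encList, List.tail_drop])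
  exact this.hd.congr fun i => by simp [hd_encList]

theorem tabulate {n : ι → ℕ} {v : ι → ℕ → Val} (hn : Cmp s x (fun i => encUnary (n i)))
    (hb : PolyBounded n s)
    (hv : Cmp (fun p : Σ i, Fin (n i) => s p.1) (fun p => .cons (x p.1) (encUnary p.2))
      (fun p => v p.1 p.2)) :
    Cmp s x (fun i => encList ((List.range (n i)).map (v i))) := by
  have := natrec (s := s) (x := x) (n := n)
    (σ := fun i j => encList ((List.range j).map fun r => v i (n i - j + r))) hn hb nil ?_
  · exact this.congr fun i => by simp
  have hj : Cmp (fun p : Σ i, Fin (n i) => s p.1)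
      (fun p => .cons (x p.1) (.cons (encUnary p.2)
        (encList ((List.range p.2).map fun r => v p.1 (n p.1 - p.2 + r)))))
      (fun p => encUnary (n p.1 - (p.2 + 1))) :=
    sub (hn.up _ _) (succ (fst (snd id))) ((hb.comp _).mono fun p => p.2.2)
  have hv' := ((fst id).cons hj).comp (hv.reindex fun p : Σ i, Fin (n i) =>
    ⟨p.1, ⟨n p.1 - (p.2 + 1), by have := p.2.2; omega⟩⟩)
  refine (hv'.cons (snd (snd id))).congr fun p => ?_
  rw [List.range_succ_eq_map, List.map_cons, List.map_map]
  have hp := p.2.2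
  simp only [encList, List.foldr_cons, Nat.add_zero]
  congr 3
  funext r
  simp only [Function.comp]
  congr 1
  omega

end Cmp

end Lisp

/-! ### Polynomials truncated in degree, with residues in unary -/

namespace Lisp

open Polynomial

/-- The residue of an integer, as a natural number. -/
def res (m : ℕ) (z : ℤ) : ℕ := (z % (m : ℤ)).toNat

theorem mod_eq_res {m a : ℕ} {z : ℤ} (h : (a : ℤ) ≡ z [ZMOD m]) : a % m = res m z := by
  rw [res, ← h, ← Int.natCast_mod, Int.toNat_natCast]

theorem res_modEq {m : ℕ} (hm : 0 < m) (z : ℤ) : (res m z : ℤ) ≡ z [ZMOD m] := by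
  rw [res, Int.toNat_of_nonneg (Int.emod_nonneg _ (by omega))]
  exact Int.mod_modEq _ _

theorem res_lt {m : ℕ} (hm : 0 < m) (z : ℤ) : res m z < m := by
  have := Int.emod_lt_of_pos z (show (0 : ℤ) < m by omega)
  have := Int.emod_nonneg z (show (m : ℤ) ≠ 0 by omega)
  simp only [res]
  omega

/-- The residues modulo `m`, in unary, of the coefficients of a polynomial in degrees less than
`D`. -/
def rep (D m : ℕ) (a : ℤ[X]) : Val :=
  encList ((List.range D).map fun j => encUnary (res m (a.coeff j)))

/-- A square matrix of polynomials. -/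
def repMatrix (D m K : ℕ) (A : ℕ → ℕ → ℤ[X]) : Val :=
  encList ((List.range K).map fun u => encList ((List.range K).map fun v => rep D m (A u v)))

/-- The bound `D` for the degrees and the modulus `m` can be computed, and are not too large. -/
structure Params {ι : Type} (s : ι → ℕ) (x : ι → Val) (D m : ι → ℕ) : Prop where
  deg : Cmp s x (fun i => encUnary (D i))
  deg_le : PolyBounded D s
  modulus : Cmp s x (fun i => encUnary (m i))
  modulus_le : PolyBounded m s
  pos : ∀ i, 0 < m i

variable {ι κ : Type} {s : ι → ℕ} {x y z : ι → Val} {D m : ι → ℕ}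

namespace Params

theorem reindex (h : Params s x D m) (φ : κ → ι) :
    Params (fun p => s (φ p)) (fun p => x (φ p)) (fun p => D (φ p)) (fun p => m (φ p)) :=
  ⟨h.deg.reindex φ, h.deg_le.comp φ, h.modulus.reindex φ, h.modulus_le.comp φ, fun _ => h.pos _⟩

theorem of_cmp (h : Params s x D m) (h' : Cmp s y x) : Params s y D m :=
  ⟨h'.comp h.deg, h.deg_le, h'.comp h.modulus, h.modulus_le, h.pos⟩

theorem up (h : Params s x D m) (φ : κ → ι) (w : κ → Val) :
    Params (fun p => s (φ p)) (fun p => .cons (x (φ p)) (w p)) (fun p => D (φ p))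
      (fun p => m (φ p)) :=
  (h.reindex φ).of_cmp (.fst .id)

end Params

namespace Cmp

theorem sum_mod {n : ι → ℕ} {f : ι → ℕ → ℕ} (h : Params s x D m)
    (hn : Cmp s x (fun i => encUnary (n i))) (hb : PolyBounded n s)
    (hf : Cmp (fun p : Σ i, Fin (n i) => s p.1) (fun p => .cons (x p.1) (encUnary p.2))
      (fun p => encUnary (f p.1 p.2)))
    (hf' : PolyBounded (fun p : Σ i, Fin (n i) => f p.1 p.2) (fun p => s p.1)) :
    Cmp s x (fun i => encUnary ((∑ j ∈ Finset.range (n i), f i j) % m i)) := by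
  refine natrec (σ := fun i j => encUnary ((∑ j ∈ Finset.range j, f i j) % m i)) hn hb
    ((unary 0).congr fun i => by simp) ?_
  refine (mod (add (snd (snd id)) (((fst id).cons (fst (snd id))).comp hf) hf') ?_
    (h.modulus.up _ _) (h.modulus_le.comp _)).congr fun p => ?_
  · refine PolyBounded.add ((h.modulus_le.comp _).mono fun p => (Nat.mod_lt _ (h.pos _)).le) hf'
  · rw [Finset.sum_range_succ, Nat.mod_add_mod]

/-- Coefficients of represented polynomials can be computed. -/
theorem coeff {a : ι → ℤ[X]} {j : ι → ℕ} (h : Params s x D m)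
    (ha : Cmp s x (fun i => rep (D i) (m i) (a i))) (hj : Cmp s x (fun i => encUnary (j i)))
    (hj' : ∀ i, j i < D i) : Cmp s x (fun i => encUnary (res (m i) ((a i).coeff (j i)))) :=
  (getD ha hj (h.deg_le.mono fun i => (hj' i).le)).congr fun i => by
    rw [List.getD_eq_getElem?_getD, List.getElem?_map, List.getElem?_range (hj' i)]
    rfl

theorem rep_of_coeff {a : ι → ℤ[X]} (h : Params s x D m) {f : ι → ℕ → ℕ}
    (hf : Cmp (fun p : Σ i, Fin (D i) => s p.1) (fun p => .cons (x p.1) (encUnary p.2))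
      (fun p => encUnary (f p.1 p.2)))
    (hfa : ∀ i, ∀ j < D i, f i j = res (m i) ((a i).coeff j)) :
    Cmp s x (fun i => rep (D i) (m i) (a i)) := by
  refine (tabulate (v := fun i j => encUnary (f i j)) h.deg h.deg_le hf).congr fun i => ?_
  rw [rep]
  congr 1
  exact List.map_congr_left fun j hj => by rw [hfa i j (List.mem_range.1 hj)]

theorem rep_zero (h : Params s x D m) : Cmp s x (fun i => rep (D i) (m i) 0) :=
  rep_of_coeff (f := fun _ _ => 0) h (unary 0) fun i j _ => by simp [res]

theorem rep_one (h : Params s x D m) : Cmp s x (fun i => rep (D i) (m i) 1) := by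
  refine rep_of_coeff (f := fun i j => (if j = 0 then 1 else 0) % m i) h ?_ fun i j _ => ?_
  · refine mod (iteNat (eq_zero last) (unary 1) (unary 0)) ?_ (h.modulus.up _ _)
      (h.modulus_le.comp _)
    exact (PolyBounded.const 1).mono fun p => by split <;> simp
  · refine mod_eq_res ?_
    rw [coeff_one]
    by_cases hj : j = 0 <;> simp [hj, Int.ModEq.refl]

theorem rep_add {a b : ι → ℤ[X]} (h : Params s x D m)
    (ha : Cmp s x (fun i => rep (D i) (m i) (a i)))
    (hb : Cmp s x (fun i => rep (D i) (m i) (b i))) :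
    Cmp s x (fun i => rep (D i) (m i) (a i + b i)) := by
  have bd : ∀ a : ι → ℤ[X], PolyBounded
      (fun p : Σ i, Fin (D i) => res (m p.1) ((a p.1).coeff p.2)) (fun p => s p.1) := fun a =>
    (h.modulus_le.comp _).mono fun p => (res_lt (h.pos _) _).le
  refine rep_of_coeff (f := fun i j => (res (m i) ((a i).coeff j) + res (m i) ((b i).coeff j)) %
    m i) h ?_ fun i j _ => ?_
  · have h' := h.up (Sigma.fst : (Σ i, Fin (D i)) → ι) (fun p => encUnary p.2)
    exact mod (add (coeff h' (ha.up _ _) last fun p => p.2.2)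
      (coeff h' (hb.up _ _) last fun p => p.2.2) (bd b)) ((bd a).add (bd b)) h'.modulus h'.modulus_le
  · refine mod_eq_res ?_
    rw [coeff_add, Nat.cast_add]
    exact (res_modEq (h.pos i) _).add (res_modEq (h.pos i) _)

theorem rep_neg {a : ι → ℤ[X]} (h : Params s x D m)
    (ha : Cmp s x (fun i => rep (D i) (m i) (a i))) :
    Cmp s x (fun i => rep (D i) (m i) (-a i)) := by
  refine rep_of_coeff (f := fun i j => (m i - res (m i) ((a i).coeff j)) % m i) h ?_ fun i j _ => ?_
  · have h' := h.up (Sigma.fst : (Σ i, Fin (D i)) → ι) (fun p => encUnary p.2)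
    refine mod (sub h'.modulus (coeff h' (ha.up _ _) last fun p => p.2.2) ?_) ?_ h'.modulus
      h'.modulus_le
    · exact h'.modulus_le.mono fun p => (res_lt (h.pos _) _).le
    · exact h'.modulus_le.mono fun p => Nat.sub_le _ _
  · refine mod_eq_res ?_
    rw [coeff_neg, Nat.cast_sub (res_lt (h.pos i) _).le]
    simpa using ((Int.ModEq.refl (m i : ℤ)).sub (res_modEq (h.pos i) ((a i).coeff j))).trans
      (show (m i : ℤ) - (a i).coeff j ≡ 0 - (a i).coeff j [ZMOD m i] from
        Int.ModEq.sub (by simp [Int.ModEq]) rfl)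

theorem rep_sub {a b : ι → ℤ[X]} (h : Params s x D m)
    (ha : Cmp s x (fun i => rep (D i) (m i) (a i)))
    (hb : Cmp s x (fun i => rep (D i) (m i) (b i))) :
    Cmp s x (fun i => rep (D i) (m i) (a i - b i)) :=
  (rep_add h ha (rep_neg h hb)).congr fun i => by rw [sub_eq_add_neg]

/-- A coefficient of the product in degree `j < D` involves only degrees at most `j`, so truncation
at `D` is compatible with multiplication: the arithmetic takes place in `(ℤ/m)[X]/(X ^ D)`. -/
theorem rep_mul {a b : ι → ℤ[X]} (h : Params s x D m)
    (ha : Cmp s x (fun i => rep (D i) (m i) (a i)))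
    (hb : Cmp s x (fun i => rep (D i) (m i) (b i))) :
    Cmp s x (fun i => rep (D i) (m i) (a i * b i)) := by
  refine rep_of_coeff (f := fun i j => (∑ l ∈ Finset.range (j + 1),
    res (m i) ((a i).coeff l) * res (m i) ((b i).coeff (j - l))) % m i) h ?_ fun i j _ => ?_
  · have h' := h.up (Sigma.fst : (Σ i, Fin (D i)) → ι) (fun p => encUnary p.2)
    refine sum_mod (n := fun p : Σ i, Fin (D i) => p.2 + 1)
      (f := fun p l => res (m p.1) ((a p.1).coeff l) * res (m p.1) ((b p.1).coeff (p.2 - l)))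
      h' (succ last) (h'.deg_le.mono fun p => p.2.2) ?_ ?_
    · have ha' := ha.up (Sigma.fst : (Σ i, Fin (D i)) → ι) (fun p => encUnary p.2)
      have hb' := hb.up (Sigma.fst : (Σ i, Fin (D i)) → ι) (fun p => encUnary p.2)
      have h'' := h'.up (Sigma.fst : (Σ p : (Σ i, Fin (D i)), Fin (p.2 + 1)) → _)
        (fun p => encUnary p.2)
      have hp : ∀ p : (Σ p : (Σ i, Fin (D i)), Fin (p.2 + 1)), (p.2 : ℕ) ≤ p.1.2 :=
        fun p => Nat.lt_succ_iff.1 p.2.2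
      refine mul (coeff h'' (ha'.up _ _) last fun p => ?_) ?_
        (coeff h'' (hb'.up _ _) (sub
          (a := fun p : (Σ p : (Σ i, Fin (D i)), Fin (p.2 + 1)) => p.1.2) (snd (fst id)) last ?_) fun p => ?_) ?_
      · exact (hp p).trans_lt p.1.2.2
      · exact h''.modulus_le.mono fun p => (res_lt (h''.pos p) _).le
      · exact h''.deg_le.mono fun p => ((hp p).trans_lt p.1.2.2).le
      · exact (Nat.sub_le _ _).trans_lt p.1.2.2
      · exact h''.modulus_le.mono fun p => (res_lt (h''.pos p) _).le
    · refine ((h.modulus_le.mul h.modulus_le).comp _).mono fun p => ?_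
      exact Nat.mul_le_mul (res_lt (h.pos _) _).le (res_lt (h.pos _) _).le
  · refine mod_eq_res ?_
    rw [coeff_mul, Finset.Nat.sum_antidiagonal_eq_sum_range_succ_mk, Nat.cast_sum]
    refine Int.ModEq.sum fun l _ => ?_
    rw [Nat.cast_mul]
    exact (res_modEq (h.pos i) _).mul (res_modEq (h.pos i) _)

theorem rep_sum {n : ι → ℕ} {a : ι → ℕ → ℤ[X]} (h : Params s x D m)
    (hn : Cmp s x (fun i => encUnary (n i))) (hb : PolyBounded n s)
    (ha : Cmp (fun p : Σ i, Fin (n i) => s p.1) (fun p => .cons (x p.1) (encUnary p.2))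
      (fun p => rep (D p.1) (m p.1) (a p.1 p.2))) :
    Cmp s x (fun i => rep (D i) (m i) (∑ j ∈ Finset.range (n i), a i j)) := by
  refine natrec (σ := fun i j => rep (D i) (m i) (∑ j ∈ Finset.range j, a i j)) hn hb
    ((rep_zero h).congr fun i => by simp) ?_
  refine (rep_add (h.up _ _) (snd (snd id)) (((fst id).cons (fst (snd id))).comp ha)).congr
    fun p => ?_
  rw [Finset.sum_range_succ]

theorem getD_range {n : ι → ℕ} {v : ι → ℕ → Val} {j : ι → ℕ}
    (hl : Cmp s x (fun i => encList ((List.range (n i)).map (v i))))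
    (hj : Cmp s x (fun i => encUnary (j i))) (hb : PolyBounded n s) (hj' : ∀ i, j i < n i) :
    Cmp s x (fun i => v i (j i)) :=
  (getD hl hj (hb.mono fun i => (hj' i).le)).congr fun i => by
    rw [List.getD_eq_getElem?_getD, List.getElem?_map, List.getElem?_range (hj' i)]
    rfl

theorem entry {K u v : ι → ℕ} {A : ι → ℕ → ℕ → ℤ[X]}
    (hA : Cmp s x (fun i => repMatrix (D i) (m i) (K i) (A i))) (hK : PolyBounded K s)
    (hu : Cmp s x (fun i => encUnary (u i))) (hv : Cmp s x (fun i => encUnary (v i)))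
    (hu' : ∀ i, u i < K i) (hv' : ∀ i, v i < K i) :
    Cmp s x (fun i => rep (D i) (m i) (A i (u i) (v i))) :=
  getD_range (n := K) (v := fun i v => rep (D i) (m i) (A i (u i) v))
    (getD_range (n := K) (v := fun i u => encList ((List.range (K i)).map fun v =>
      rep (D i) (m i) (A i u v))) hA hu hK hu') hv hK hv'

theorem repMatrix_of_entry {K : ι → ℕ} {A : ι → ℕ → ℕ → ℤ[X]}
    (hK : Cmp s x (fun i => encUnary (K i))) (hb : PolyBounded K s)
    (hA : Cmp (fun p : Σ p : (Σ i, Fin (K i)), Fin (K p.1) => s p.1.1)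
      (fun p => .cons (.cons (x p.1.1) (encUnary p.1.2)) (encUnary p.2))
      (fun p => rep (D p.1.1) (m p.1.1) (A p.1.1 p.1.2 p.2))) :
    Cmp s x (fun i => repMatrix (D i) (m i) (K i) (A i)) :=
  tabulate hK hb (v := fun i u => encList ((List.range (K i)).map fun v =>
      rep (D i) (m i) (A i u v))) (tabulate (n := fun p : Σ i, Fin (K i) => K p.1)
        (v := fun p v => rep (D p.1) (m p.1) (A p.1 p.2 v)) (hK.up _ _) (hb.comp _) hA)

/-! #### Conversion between binary and unary -/

theorem unary_of_int {z : ι → ℤ} {k : ι → ℕ} (hz : Cmp s x (fun i => encInt (z i)))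
    (hk : Cmp s x (fun i => encUnary (k i))) (hb : PolyBounded (fun i => 2 ^ k i) s) :
    Cmp s x (fun i => encUnary (res (2 ^ k i) (z i))) := by
  have hkb : PolyBounded k s := hb.mono fun i => Nat.lt_two_pow_self.le
  have hm := two_pow hk hb
  have habs : Cmp s x (fun i => encUnary ((z i).natAbs % 2 ^ k i)) := by
    -- Only the lowest `k` bits are read, each set bit `j` adding `2 ^ j`. Beyond the end of the bit
    -- list the default `nil` is the encoding of a zero bit.
    refine natrec (σ := fun i j => encUnary ((z i).natAbs % 2 ^ j)) hk hkb
      ((unary 0).congr fun i => by simp [Nat.mod_one]) ?_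
    have hp : PolyBounded (fun p : Σ i, Fin (k i) => 2 ^ (p.2 : ℕ)) (fun p => s p.1) :=
      (hb.comp _).mono fun p => Nat.pow_le_pow_right two_pos p.2.2.le
    have hbit : Cmp (fun p : Σ i, Fin (k i) => s p.1)
        (fun p => .cons (x p.1) (.cons (encUnary p.2) (encUnary ((z p.1).natAbs % 2 ^ (p.2 : ℕ)))))
        (fun p => encBool (decide ((z p.1).natAbs.testBit p.2 = true))) := by
      refine (getD ((snd hz).up _ _) (fst (snd id)) ((hkb.comp _).mono fun p => p.2.2.le)).congr
        fun p => ?_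
      rw [List.getD_eq_getElem?_getD, List.getElem?_map, Bool.decide_eq_true,
        Nat.testBit_eq_inth, List.getI_eq_getElem?_getD]
      cases (z p.1).natAbs.bits[(p.2 : ℕ)]? <;> rfl
    refine (iteNat hbit (add (snd (snd id)) (two_pow (fst (snd id)) hp) hp)
      (snd (snd id))).congr fun p => ?_
    congr 1
    rw [pow_succ, Nat.mod_mul, Nat.testBit_eq_decide_div_mod_eq]
    rcases Nat.mod_two_eq_zero_or_one ((z p.1).natAbs / 2 ^ (p.2 : ℕ)) with h | h <;> simp [h]
  have hlt : ∀ i, (z i).natAbs % 2 ^ k i < 2 ^ k i := fun i => Nat.mod_lt _ (by positivity)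
  have hab : PolyBounded (fun i => (z i).natAbs % 2 ^ k i) s := hb.mono fun i => (hlt i).le
  -- The outer `mod` is for negative `z` divisible by `2 ^ k`, where the difference is `2 ^ k`
  -- itself.
  refine (mod (iteNat (p := fun i => z i < 0) (fst hz) (sub hm habs hab) habs) ?_ hm hb).congr
    fun i => ?_
  · exact hb.mono fun i => by
      have := hlt i
      split <;> omega
  · congr 1
    apply mod_eq_res
    split_ifs with h
    · rw [Nat.cast_sub (hlt i).le, Int.natCast_mod, Int.ofNat_natAbs_of_nonpos h.le]
      have h1 : -z i % ((2 ^ k i : ℕ) : ℤ) ≡ -z i [ZMOD ((2 ^ k i : ℕ) : ℤ)] := Int.mod_modEq _ _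
      have h2 : ((2 ^ k i : ℕ) : ℤ) ≡ 0 [ZMOD ((2 ^ k i : ℕ) : ℤ)] := by simp [Int.ModEq]
      simpa using h2.sub h1
    · rw [Int.natCast_mod, Int.natAbs_of_nonneg (by omega)]
      exact Int.mod_modEq _ _

theorem nat_of_unary {a : ι → ℕ} (ha : Cmp s x (fun i => encUnary (a i)))
    (hb : PolyBounded a s) : Cmp s x (fun i => encNat (a i)) := by
  let κ := Σ i, Fin (a i + 1)
  have hp : PolyBounded (fun p : κ => (p.2 : ℕ)) (fun p => s p.1) :=
    (hb.comp _).mono fun p => Nat.lt_succ_iff.1 p.2.2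
  have key : Cmp (fun p : κ => s p.1) (fun p => encUnary p.2) (fun p => encNat p.2) := by
    refine tree (leaf := fun p => (p.2 : ℕ) = 0)
      (φ := fun p => ⟨p.1, p.2 / 2, (Nat.div_le_self _ _).trans_lt p.2.2⟩)
      (ψ := fun p => ⟨p.1, 0⟩) (cnt := fun p => 2 * p.2 + 1) (eq_zero id) ?_ ?_ ?_ ?_
      (fun p _ => le_rfl) (fun p _ => le_rfl) ?_ ?_ ?_
    · exact nil.congr fun p => by rw [p.2]; rfl
    · exact div id (hp.comp _) (unary 2) (.const 2)
    · exact nil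
    · have h1 : Cmp (fun p : {p : κ // ¬ (p.2 : ℕ) = 0} => s p.1.1) (fun p => .cons (encUnary p.1.2)
          (.cons (encNat (p.1.2 / 2)) (encNat 0)))
          (fun p => encBool (decide ((p.1.2 : ℕ) % 2 = 1))) :=
        eq (mod (fst id) (hp.comp _) (unary 2) (.const 2)) ((PolyBounded.const 2).mono fun p =>
          (Nat.mod_lt _ two_pos).le) (unary 1) (.const 1)
      refine (h1.cons (fst (snd id))).congr fun p => ?_
      have hp := p.2
      generalize (p.1.2 : ℕ) = b at hp
      -- The parity of `b` is the head of the bit list and `b / 2` gives the tail. This needs `b ≠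
      -- 0`, as zero has no bits.
      conv_rhs => rw [encNat, ← Nat.bit_bodd_div2 b, Nat.bits_append_bit _ _ (by
        intro h
        have := Nat.bit_bodd_div2 b
        rw [h] at this
        cases hb : b.bodd
        · rw [hb] at this
          exact absurd this.symm hp
        · rfl)]
      rw [Nat.div2_val]
      have := Nat.mod_two_of_bodd b
      cases hb : b.bodd <;> simp [encNat, encList, this, hb]
    · intro p hp
      change 1 + (2 * (p.2 / 2 : ℕ) + 1) + 1 ≤ 2 * (p.2 : ℕ) + 1
      omega
    · intro p
      omega
    · exact ((PolyBounded.const 2).mul hp).add (.const 1)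
  exact ha.comp (key.reindex fun i => ⟨i, ⟨a i, Nat.lt_succ_self _⟩⟩)

end Cmp

end Lisp

/-! ### Pairings, crossings and the Pfaffian -/

namespace Haf

open Finset

variable {V : Type*} [LinearOrder V]

/-- The partitions of a finite subset of `V` into pairs. -/
def pairingsOn (S : Finset V) : Finset (Finset (Sym2 V)) :=
  S.sym2.powerset.filter fun M =>
    (∀ e ∈ M, ¬ e.IsDiag) ∧ ∀ v ∈ S, (M.filter fun e => v ∈ e).card = 1

theorem pairingsOn_univ [Fintype V] : pairingsOn (univ : Finset V) = pairings V := by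
  ext M
  simp [pairingsOn, pairings]

theorem mem_pairingsOn {S : Finset V} {M : Finset (Sym2 V)} :
    M ∈ pairingsOn S ↔ (∀ e ∈ M, ¬ e.IsDiag ∧ ∀ x ∈ e, x ∈ S) ∧
      ∀ v ∈ S, ∃! e, e ∈ M ∧ v ∈ e := by
  have h : ∀ v, (M.filter fun e => v ∈ e).card = 1 ↔ ∃! e, e ∈ M ∧ v ∈ e := fun v => by
    rw [card_eq_one]
    constructor
    · rintro ⟨e, he⟩
      have h : ∀ e', (e' ∈ M ∧ v ∈ e') ↔ e' = e := fun e' => by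
        rw [← mem_singleton, ← he, mem_filter]
      exact ⟨e, (h e).2 rfl, fun e' h' => (h e').1 h'⟩
    · rintro ⟨e, he, hu⟩
      refine ⟨e, ?_⟩
      ext e'
      rw [mem_filter, mem_singleton]
      exact ⟨hu e', fun h => h ▸ he⟩
  simp only [pairingsOn, mem_filter, mem_powerset, h, subset_iff, mem_sym2_iff]
  constructor
  · rintro ⟨h1, h2, h3⟩
    exact ⟨fun e he => ⟨h2 e he, h1 he⟩, h3⟩
  · rintro ⟨h1, h3⟩
    exact ⟨fun e he => (h1 e he).2, fun e he => (h1 e he).1, h3⟩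

theorem pairingsOn_empty : pairingsOn (∅ : Finset V) = {∅} := by
  ext M
  rw [mem_pairingsOn, mem_singleton]
  constructor
  · rintro ⟨h, -⟩
    refine eq_empty_of_forall_notMem fun e he => ?_
    induction e with
    | h a b => simpa using (h _ he).2 a (by simp)
  · rintro rfl
    simp

/-- Sums over pairings, expanded according to the partner of the smallest element. -/
theorem sum_pairingsOn_insert {α : Type*} [AddCommMonoid α] {v : V} {S : Finset V}
    (hv : ∀ w ∈ S, v < w) (g : Finset (Sym2 V) → α) :
    ∑ M ∈ pairingsOn (insert v S), g M =
      ∑ w ∈ S, ∑ M ∈ pairingsOn (S.erase w), g (insert s(v, w) M) := by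
  have hvS : v ∉ S := fun h => lt_irrefl _ (hv v h)
  have hnot : ∀ {w M}, M ∈ pairingsOn (S.erase w) → ∀ e ∈ M, v ∉ e ∧ w ∉ e :=
    fun hM e he => ⟨fun h => hvS (mem_of_mem_erase (((mem_pairingsOn.1 hM).1 e he).2 _ h)),
      fun h => (mem_erase.1 (((mem_pairingsOn.1 hM).1 e he).2 _ h)).1 rfl⟩
  have hnot' : ∀ {w M}, M ∈ pairingsOn (S.erase w) → s(v, w) ∉ M :=
    fun hM h => (hnot hM _ h).1 (by simp)
  rw [Finset.sum_sigma']
  symm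
  refine Finset.sum_bij (fun p _ => insert s(v, p.1) p.2) ?_ ?_ ?_ fun _ _ => rfl
  · rintro ⟨w, M⟩ h
    obtain ⟨hw, hM⟩ := mem_sigma.1 h
    simp only at hw hM ⊢
    have hM' := mem_pairingsOn.1 hM
    have hvw := hv w hw
    rw [mem_pairingsOn]
    constructor
    · intro e he
      rcases mem_insert.1 he with rfl | he
      · refine ⟨by simpa using hvw.ne, fun x hx => ?_⟩
        rcases Sym2.mem_iff.1 hx with rfl | rfl
        · simp
        · simp [hw]
      · exact ⟨(hM'.1 e he).1, fun x hx => mem_insert_of_mem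
          (mem_of_mem_erase ((hM'.1 e he).2 x hx))⟩
    · intro x hx
      by_cases hx' : x ∈ s(v, w)
      · refine ⟨s(v, w), ⟨mem_insert_self _ _, hx'⟩, fun e ⟨he, hxe⟩ => ?_⟩
        rcases mem_insert.1 he with rfl | he
        · rfl
        · have := hnot hM e he
          rcases Sym2.mem_iff.1 hx' with rfl | rfl
          · exact absurd hxe this.1
          · exact absurd hxe this.2
      · simp only [Sym2.mem_iff, not_or] at hx'
        obtain ⟨e, ⟨he, hxe⟩, hu⟩ := hM'.2 x
          (mem_erase.2 ⟨hx'.2, (mem_insert.1 hx).resolve_left hx'.1⟩)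
        refine ⟨e, ⟨mem_insert_of_mem he, hxe⟩, fun e' ⟨he', hxe'⟩ => ?_⟩
        rcases mem_insert.1 he' with rfl | he'
        · simp [hx'] at hxe'
        · exact hu e' ⟨he', hxe'⟩
  · rintro ⟨w, M⟩ h ⟨w', M'⟩ h' heq
    obtain ⟨hw, hM⟩ := mem_sigma.1 h
    obtain ⟨hw', hM'⟩ := mem_sigma.1 h'
    simp only at hw hM hw' hM' heq
    have h1 : s(v, w) ∈ insert s(v, w') M' := heq ▸ mem_insert_self _ _
    rcases mem_insert.1 h1 with h1 | h1
    · have hww : w = w' := Sym2.congr_right.1 h1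
      subst hww
      rw [← erase_insert (hnot' hM), heq, erase_insert (hnot' hM')]
    · exact absurd (by simp) (hnot hM' _ h1).1
  · intro K hK
    have hK' := mem_pairingsOn.1 hK
    obtain ⟨e, ⟨heK, hve⟩, hu⟩ := hK'.2 v (mem_insert_self _ _)
    obtain ⟨w, rfl⟩ := Sym2.mem_iff_exists.1 hve
    have he := hK'.1 _ heK
    have hwv : w ≠ v := fun h => he.1 (by simp [h])
    have hw : w ∈ S := (mem_insert.1 (he.2 w (by simp))).resolve_left hwv
    refine ⟨⟨w, K.erase s(v, w)⟩, mem_sigma.2 ⟨hw, mem_pairingsOn.2 ⟨fun e he' => ?_,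
      fun x hx => ?_⟩⟩, insert_erase heK⟩
    · obtain ⟨hne, heK'⟩ := mem_erase.1 he'
      refine ⟨(hK'.1 e heK').1, fun x hx => mem_erase.2 ⟨?_, ?_⟩⟩
      · rintro rfl
        exact hne ((hK'.2 x (mem_insert_of_mem hw)).unique ⟨heK', hx⟩ ⟨heK, by simp⟩)
      · refine (mem_insert.1 ((hK'.1 e heK').2 x hx)).resolve_left ?_
        rintro rfl
        exact hne (hu e ⟨heK', hx⟩)
    · obtain ⟨hxw, hxS⟩ := mem_erase.1 hx
      obtain ⟨e, ⟨he1, he2⟩, hu'⟩ := hK'.2 x (mem_insert_of_mem hxS)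
      refine ⟨e, ⟨mem_erase.2 ⟨?_, he1⟩, he2⟩, fun e' ⟨he', hx'⟩ =>
        hu' e' ⟨mem_of_mem_erase he', hx'⟩⟩
      rintro rfl
      rcases Sym2.mem_iff.1 he2 with rfl | rfl
      · exact hvS hxS
      · exact hxw rfl

/-- The pairs `e` and `f` cross, and `e` has the smaller minimum. -/
def Cross (e f : Sym2 V) : Prop := e.inf < f.inf ∧ f.inf < e.sup ∧ e.sup < f.sup

instance (e f : Sym2 V) : Decidable (Cross e f) := inferInstanceAs (Decidable (_ ∧ _ ∧ _))

/-- The parity of the number of crossings of a pairing. -/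
def crossSign (M : Finset (Sym2 V)) : ℤ := ∏ e ∈ M, ∏ f ∈ M, if Cross e f then -1 else 1

/-- As `v` is the minimum, a pair of `M` crosses `{v, w}` exactly when one of its two elements is
below `w`. Modulo 2 this counts its elements below `w`, and the pairs of `M` partition `S` without
`w`. -/
theorem prod_cross {v w : V} {S : Finset V} (hv : ∀ w ∈ S, v < w) (hw : w ∈ S)
    {M : Finset (Sym2 V)} (hM : M ∈ pairingsOn (S.erase w)) :
    (∏ f ∈ M, if Cross s(v, w) f then (-1 : ℤ) else 1) = (-1) ^ (S.filter (· < w)).card := by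
  have hM' := mem_pairingsOn.1 hM
  have h1 : S.filter (· < w) = M.biUnion fun f => f.toFinset.filter (· < w) := by
    ext z
    simp only [mem_filter, mem_biUnion, Sym2.mem_toFinset]
    constructor
    · rintro ⟨hz, hzw⟩
      obtain ⟨e, he, -⟩ := hM'.2 z (mem_erase.2 ⟨hzw.ne, hz⟩)
      exact ⟨e, he.1, he.2, hzw⟩
    · rintro ⟨e, he, hze, hzw⟩
      exact ⟨mem_of_mem_erase ((hM'.1 e he).2 z hze), hzw⟩
  rw [h1, card_biUnion, ← prod_pow_eq_pow_sum]
  · refine prod_congr rfl fun f hf => ?_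
    have hf' := hM'.1 f hf
    induction f with
    | h a b =>
      have hab : a ≠ b := by simpa using hf'.1
      have ha := mem_erase.1 (hf'.2 a (by simp))
      have hb := mem_erase.1 (hf'.2 b (by simp))
      have hva := hv a ha.2
      have hvb := hv b hb.2
      have hvw := hv w hw
      simp only [Cross, Sym2.inf_mk, Sym2.sup_mk, Sym2.toFinset_mk_eq, filter_insert,
        filter_singleton, inf_eq_left.2 hvw.le, sup_eq_right.2 hvw.le, lt_inf_iff, inf_lt_iff,
        lt_sup_iff, hva, hvb, true_and, and_self]
      rcases lt_or_gt_of_ne ha.1 with h | h <;> rcases lt_or_gt_of_ne hb.1 with h' | h' <;>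
        simp [h, h', not_lt.2 h.le, not_lt.2 h'.le, hab]
  · intro e he f hf hef
    rw [Function.onFun, disjoint_left]
    intro z hz hz'
    rw [mem_filter, Sym2.mem_toFinset] at hz hz'
    exact hef ((hM'.2 z ((hM'.1 e he).2 z hz.1)).unique ⟨he, hz.1⟩ ⟨hf, hz'.1⟩)

/-- No pair has its minimum below `v`, so `{v, w}` can only be the first member of a crossing, and
`prod_cross` counts those crossings. -/
theorem crossSign_insert {v w : V} {S : Finset V} (hv : ∀ w ∈ S, v < w) (hw : w ∈ S)
    {M : Finset (Sym2 V)} (hM : M ∈ pairingsOn (S.erase w)) :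
    crossSign (insert s(v, w) M) = (-1) ^ (S.filter (· < w)).card * crossSign M := by
  have hM' := mem_pairingsOn.1 hM
  have hvw := hv w hw
  have hnot : s(v, w) ∉ M := fun h =>
    lt_irrefl _ (hv v (mem_of_mem_erase ((hM'.1 _ h).2 v (by simp))))
  have h0 : ∀ e, (∀ x ∈ e, v ≤ x) → ¬ Cross e s(v, w) := by
    intro e he h
    have : e.inf < v := by simpa [hvw.le] using h.1
    induction e with
    | h a b =>
      rw [Sym2.inf_mk, inf_lt_iff] at this
      rcases this with h | h
      · exact not_lt.2 (he a (by simp)) h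
      · exact not_lt.2 (he b (by simp)) h
  have h1 : ∀ e ∈ M, (∏ f ∈ insert s(v, w) M, if Cross e f then (-1 : ℤ) else 1) =
      ∏ f ∈ M, if Cross e f then (-1 : ℤ) else 1 := fun e he => by
    rw [prod_insert hnot, if_neg (h0 e fun x hx =>
      (hv x (mem_of_mem_erase ((hM'.1 e he).2 x hx))).le), one_mul]
  rw [crossSign, prod_insert hnot, prod_insert hnot, if_neg (h0 _ (by simp [hvw.le])), one_mul,
    prod_cross hv hw hM, prod_congr rfl h1, crossSign]

variable {R : Type*} [CommRing R]

/-- The weight of a pairing. -/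
def weight (A : V → V → R) (M : Finset (Sym2 V)) : R := ∏ e ∈ M, A e.inf e.sup

/-- The Pfaffian of the alternating matrix with entries `A i j` above the diagonal. -/
def pfaffian (A : V → V → R) (S : Finset V) : R := ∑ M ∈ pairingsOn S, crossSign M * weight A M

theorem pfaffian_empty (A : V → V → R) : pfaffian A ∅ = 1 := by
  simp [pfaffian, pairingsOn_empty, crossSign, weight]

/-- Laplace expansion along the first row. That it follows from the definition by crossings ties the
combinatorial sign to the exterior algebra. -/
theorem pfaffian_insert (A : V → V → R) {v : V} {S : Finset V} (hv : ∀ w ∈ S, v < w) :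
    pfaffian A (insert v S) =
      ∑ w ∈ S, (-1) ^ (S.filter (· < w)).card * A v w * pfaffian A (S.erase w) := by
  rw [pfaffian, sum_pairingsOn_insert hv]
  refine sum_congr rfl fun w hw => ?_
  rw [pfaffian, mul_sum]
  refine sum_congr rfl fun M hM => ?_
  have hnot : s(v, w) ∉ M := fun h =>
    lt_irrefl _ (hv v (mem_of_mem_erase (((mem_pairingsOn.1 hM).1 _ h).2 v (by simp))))
  rw [crossSign_insert hv hw hM, weight, prod_insert hnot, weight, Sym2.inf_mk, Sym2.sup_mk,
    inf_eq_left.2 (hv w hw).le, sup_eq_right.2 (hv w hw).le]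
  push_cast
  ring

end Haf

/-! ### Pfaffians and their cofactors through the exterior algebra -/

namespace Haf

open Finset CliffordAlgebra

section Wick

variable {V R : Type*} [CommRing R]

/-- The alternating bilinear form with entries `A i j - A j i`. -/
noncomputable def altForm (A : V → V → R) : LinearMap.BilinForm R (V →₀ R) :=
  let U : LinearMap.BilinForm R (V →₀ R) :=
    Finsupp.linearCombination R fun i => Finsupp.linearCombination R (A i)
  U - U.flip

theorem altForm_single (A : V → V → R) (i j : V) :
    altForm A (Finsupp.single i 1) (Finsupp.single j 1) = A i j - A j i := by
  simp [altForm]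

theorem altForm_self (A : V → V → R) (x : V →₀ R) : altForm A x x = 0 := by
  simp [altForm]

/-- An alternating form has zero quadratic map, so `changeForm` deforms the exterior algebra into
itself. -/
theorem altForm_toQuadraticMap (A : V → V → R) :
    (-altForm A).toQuadraticMap = (0 : QuadraticForm R (V →₀ R)) - 0 := by
  ext x
  simp [altForm_self]

/-- The quasi-free functional on the exterior algebra that belongs to an alternating form. -/
noncomputable def wick (A : V → V → R) : ExteriorAlgebra R (V →₀ R) →ₗ[R] R :=
  ExteriorAlgebra.algebraMapInv.toLinearMap ∘ₗ changeForm (altForm_toQuadraticMap A)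

theorem wick_one (A : V → V → R) : wick A 1 = 1 := by
  simp [wick]

/-- `changeForm` turns multiplication by `v` into multiplication by `v` plus contraction with the
form at `v`; the scalar part of the former vanishes. The sign in `-altForm A` makes the contraction
enter with a plus. -/
theorem wick_ι_mul (A : V → V → R) (v : V →₀ R) (x : ExteriorAlgebra R (V →₀ R)) :
    wick A (ExteriorAlgebra.ι R v * x) = wick A (contractLeft (altForm A v) x) := by
  simp only [wick, LinearMap.comp_apply, AlgHom.toLinearMap_apply]
  rw [ExteriorAlgebra.ι, changeForm_ι_mul, changeForm_contractLeft]
  simp [ExteriorAlgebra.algebraMapInv]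

/-- The generator of the exterior algebra that belongs to `v`. -/
noncomputable def gen (R : Type*) [CommRing R] (v : V) : ExteriorAlgebra R (V →₀ R) :=
  ExteriorAlgebra.ι R (Finsupp.single v 1)

theorem gen_mul_gen (u v : V) : gen R u * gen R v = -(gen R v * gen R u) :=
  eq_neg_of_add_eq_zero_left (ExteriorAlgebra.ι_add_mul_swap _ _)

variable [LinearOrder V]

/-- The product of the generators in a finite set, in increasing order. -/
noncomputable def wedge (R : Type*) [CommRing R] (S : Finset V) : ExteriorAlgebra R (V →₀ R) :=
  ((S.sort (· ≤ ·)).map (gen R)).prod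

theorem wedge_empty : wedge R (∅ : Finset V) = 1 := by
  simp [wedge]

theorem wedge_insert {v : V} {S : Finset V} (hv : ∀ w ∈ S, v < w) :
    wedge R (insert v S) = gen R v * wedge R S := by
  rw [wedge, sort_insert (· ≤ ·) (fun w hw => (hv w hw).le) fun h => lt_irrefl _ (hv v h), List.map_cons,
    List.prod_cons, wedge]

theorem gen_mul_wedge {u : V} {S : Finset V} (hu : u ∈ S) : gen R u * wedge R S = 0 := by
  induction S using Finset.induction_on_min with
  | empty => simp at hu
  | insert v S hv ih =>
    rw [wedge_insert hv]
    rcases mem_insert.1 hu with rfl | hu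
    · rw [← mul_assoc, gen, ExteriorAlgebra.ι_sq_zero, zero_mul]
    · rw [← mul_assoc, gen_mul_gen, neg_mul, mul_assoc, ih hu, mul_zero, neg_zero]

theorem contractLeft_wedge (d : Module.Dual R (V →₀ R)) (S : Finset V) :
    contractLeft d (wedge R S) = ∑ w ∈ S, ((-1) ^ (S.filter (· < w)).card *
      d (Finsupp.single w 1)) • wedge R (S.erase w) := by
  induction S using Finset.induction_on_min with
  | empty => simp [wedge_empty]
  | insert v S hv ih =>
    have hvS : v ∉ S := fun h => lt_irrefl _ (hv v h)
    rw [wedge_insert hv, gen, ExteriorAlgebra.ι, contractLeft_ι_mul, ih, sum_insert hvS,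
      erase_insert hvS, filter_insert, if_neg (lt_irrefl v),
      filter_eq_empty_iff.2 fun w hw => not_lt.2 (hv w hw).le, card_empty, pow_zero, one_mul,
      mul_sum, sub_eq_add_neg, ← sum_neg_distrib]
    congr 1
    refine sum_congr rfl fun w hw => ?_
    have hvw := hv w hw
    rw [filter_insert, if_pos hvw, card_insert_of_notMem (by simp [hvS]), erase_insert_of_ne hvw.ne,
      wedge_insert fun z hz => hv z (mem_of_mem_erase hz), mul_smul_comm, pow_succ, mul_neg_one,
      neg_mul, neg_smul]
    rfl

/-- Both sides have the same expansion along the smallest element. The hypothesis on `A` makes the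
alternating form agree with `A` above the diagonal. -/
theorem pfaffian_eq_wick (A : V → V → R) (hA : ∀ i j, j < i → A i j = 0) (S : Finset V) :
    pfaffian A S = wick A (wedge R S) := by
  induction h : S.card using Nat.strong_induction_on generalizing S with
  | _ n ih =>
    subst h
    rcases S.eq_empty_or_nonempty with rfl | hS
    · rw [pfaffian_empty, wedge_empty, wick_one]
    · have hm := S.min'_mem hS
      have hv : ∀ w ∈ S.erase (S.min' hS), S.min' hS < w := fun w hw => S.min'_lt_of_mem_erase_min' hS hw
      have hc := card_erase_lt_of_mem hm
      generalize S.min' hS = v at *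
      rw [← insert_erase hm, pfaffian_insert A hv, wedge_insert hv, gen, wick_ι_mul,
        contractLeft_wedge, map_sum]
      refine sum_congr rfl fun w hw => ?_
      rw [map_smul, smul_eq_mul, altForm_single, hA w v (hv w hw), sub_zero,
        ih _ ((card_erase_lt_of_mem hw).trans hc) _ rfl]

/-- Up to sign, the cofactors of the Pfaffian. -/
noncomputable def cofactor (A : V → V → R) (v : V) (S : Finset V) (i : V) : R :=
  (-1) ^ (S.filter (· < i)).card * wick A (gen R v * wedge R (S.erase i))

theorem wick_gen_mul_gen (A : V → V → R) (u v : V) (S : Finset V) :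
    wick A (gen R u * (gen R v * wedge R S)) =
      (A u v - A v u) * wick A (wedge R S) - ∑ i ∈ S, (A u i - A i u) * cofactor A v S i := by
  conv_lhs => rw [gen, wick_ι_mul, gen, ExteriorAlgebra.ι, contractLeft_ι_mul, contractLeft_wedge]
  rw [map_sub, map_smul, smul_eq_mul, altForm_single, mul_sum, map_sum]
  congr 1
  refine sum_congr rfl fun i _ => ?_
  rw [mul_smul_comm, map_smul, smul_eq_mul, altForm_single, cofactor, gen, ExteriorAlgebra.ι]
  ring

/-- The linear system that the cofactors solve. -/
theorem sum_mul_cofactor (A : V → V → R) (hA : ∀ i j, j < i → A i j = 0) {u v : V} {S : Finset V}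
    (hu : u ∈ S) :
    ∑ i ∈ S, (A u i - A i u) * cofactor A v S i = (A u v - A v u) * pfaffian A S := by
  have h := wick_gen_mul_gen A u v S
  -- Since `u ∈ S`, moving `u` past `v` makes it meet its own copy in the wedge, so the left-hand
  -- side vanishes.
  rw [← mul_assoc, gen_mul_gen, neg_mul, mul_assoc, gen_mul_wedge hu, mul_zero, neg_zero,
    map_zero] at h
  rw [pfaffian_eq_wick A hA]
  exact (sub_eq_zero.1 h.symm).symm

/-- Bordering by two rows: the new Pfaffian comes from the old one and its cofactors, without any
further minors. -/
theorem pfaffian_insert_insert (A : V → V → R) (hA : ∀ i j, j < i → A i j = 0) {u v : V}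
    {S : Finset V} (huv : u < v) (hv : ∀ w ∈ S, v < w) :
    pfaffian A (insert u (insert v S)) =
      A u v * pfaffian A S - ∑ i ∈ S, A u i * cofactor A v S i := by
  rw [pfaffian_eq_wick A hA, wedge_insert (by simpa [huv] using fun w hw => huv.trans (hv w hw)),
    wedge_insert hv, wick_gen_mul_gen, pfaffian_eq_wick A hA, hA v u huv, sub_zero]
  congr 1
  refine sum_congr rfl fun i hi => ?_
  rw [hA i u (huv.trans (hv i hi)), sub_zero]

theorem cofactor_eq (A : V → V → R) (hA : ∀ i j, j < i → A i j = 0) {v : V} {S : Finset V}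
    (hv : ∀ w ∈ S, v < w) (i : V) :
    cofactor A v S i = (-1) ^ (S.filter (· < i)).card * pfaffian A (insert v (S.erase i)) := by
  rw [cofactor, pfaffian_eq_wick A hA, wedge_insert fun w hw => hv w (mem_of_mem_erase hw)]

end Wick

end Haf

/-! ### Removing the crossing signs one quadruple at a time -/

namespace Haf

open Finset

section Expansion

variable {R : Type*} [CommRing R]

/-- The sum of the weights of all pairings of a set. -/
def hafnianOn {V : Type*} [LinearOrder V] (A : V → V → R) (S : Finset V) : R :=
  ∑ M ∈ pairingsOn S, weight A M

theorem hafnianOn_insert {V : Type*} [LinearOrder V] (A : V → V → R) {v : V} {S : Finset V}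
    (hv : ∀ w ∈ S, v < w) :
    hafnianOn A (insert v S) = ∑ w ∈ S, A v w * hafnianOn A (S.erase w) := by
  rw [hafnianOn, sum_pairingsOn_insert hv]
  refine sum_congr rfl fun w hw => ?_
  rw [hafnianOn, mul_sum]
  refine sum_congr rfl fun M hM => ?_
  have hnot : s(v, w) ∉ M := fun h =>
    lt_irrefl _ (hv v (mem_of_mem_erase (((mem_pairingsOn.1 hM).1 _ h).2 v (by simp))))
  rw [weight, prod_insert hnot, weight, Sym2.inf_mk, Sym2.sup_mk,
    inf_eq_left.2 (hv w hw).le, sup_eq_right.2 (hv w hw).le]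

/-- The expansion along the smallest element uses only the order. This moves the hafnian from `Fin
K` to an initial segment of `ℕ`, where matrices of all sizes have one type. -/
theorem hafnianOn_map {U V : Type*} [LinearOrder U] [LinearOrder V] (f : U ↪o V) (A : V → V → R)
    (S : Finset U) :
    hafnianOn A (S.map f.toEmbedding) = hafnianOn (fun u v => A (f u) (f v)) S := by
  induction h : S.card using Nat.strong_induction_on generalizing S with
  | _ n ih =>
    subst h
    rcases S.eq_empty_or_nonempty with rfl | hS
    · simp [hafnianOn, pairingsOn_empty, weight]
    · have hm := S.min'_mem hS
      have hv : ∀ w ∈ S.erase (S.min' hS), S.min' hS < w :=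
        fun w hw => S.min'_lt_of_mem_erase_min' hS hw
      have hc := card_erase_lt_of_mem hm
      generalize S.min' hS = v at *
      rw [← insert_erase hm, map_insert, hafnianOn_insert, hafnianOn_insert _ hv, sum_map]
      · refine sum_congr rfl fun w hw => ?_
        rw [← map_erase, ih _ ((card_erase_lt_of_mem hw).trans hc) _ rfl]
        rfl
      · intro w hw
        obtain ⟨u, hu, rfl⟩ := mem_map.1 hw
        exact f.lt_iff_lt.2 (hv u hu)

/-- The quadruple with number `r` of elements of `{0, …, K - 1}`. -/
def quad (K r : ℕ) : ℕ × ℕ × ℕ × ℕ := (r % K, r / K % K, r / K / K % K, r / K / K / K)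

/-- The quadruple is increasing. -/
def Increasing (q : ℕ × ℕ × ℕ × ℕ) : Prop := q.1 < q.2.1 ∧ q.2.1 < q.2.2.1 ∧ q.2.2.1 < q.2.2.2

instance (q : ℕ × ℕ × ℕ × ℕ) : Decidable (Increasing q) :=
  inferInstanceAs (Decidable (_ ∧ _ ∧ _))

/-- The pairing contains the two crossing pairs that an increasing quadruple defines. -/
def CrossAt (q : ℕ × ℕ × ℕ × ℕ) (M : Finset (Sym2 ℕ)) : Prop :=
  Increasing q ∧ s(q.1, q.2.2.1) ∈ M ∧ s(q.2.1, q.2.2.2) ∈ M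

instance (q : ℕ × ℕ × ℕ × ℕ) (M : Finset (Sym2 ℕ)) : Decidable (CrossAt q M) :=
  inferInstanceAs (Decidable (_ ∧ _ ∧ _))

theorem quad_encode {K i j k l : ℕ} (hi : i < K) (hj : j < K) (hk : k < K) :
    quad K (i + K * (j + K * (k + K * l))) = (i, j, k, l) := by
  have hK : 0 < K := by omega
  simp [quad, Nat.add_mul_div_left _ _ hK, Nat.div_eq_of_lt, Nat.mod_eq_of_lt, hi, hj, hk]

theorem encode_quad (K r : ℕ) : (quad K r).1 + K * ((quad K r).2.1 + K * ((quad K r).2.2.1 +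
    K * (quad K r).2.2.2)) = r := by
  simp only [quad, Nat.mod_add_div]

/-- An ordered pair of crossing pairs is the same as the increasing quadruple of its four end
points; the quadruple is numbered by its base-`K` digits. -/
theorem crossSign_eq_prod {K : ℕ} {M : Finset (Sym2 ℕ)} (hM : M ∈ pairingsOn (range K)) :
    crossSign M = ∏ r ∈ range (K ^ 4), if CrossAt (quad K r) M then -1 else 1 := by
  have hM' := mem_pairingsOn.1 hM
  have hlt : ∀ e ∈ M, e.inf < K ∧ e.sup < K ∧ s(e.inf, e.sup) = e := by
    intro e he
    have := (hM'.1 e he).2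
    induction e with
    | h a b =>
      have ha := mem_range.1 (this a (by simp))
      have hb := mem_range.1 (this b (by simp))
      refine ⟨by simp [ha], by simp [ha, hb], ?_⟩
      rcases le_total a b with h | h
      · simp [h]
      · simp [h, Sym2.eq_swap]
  rw [crossSign, ← prod_product', prod_ite, prod_ite, prod_const_one, mul_one, prod_const_one,
    mul_one, prod_const, prod_const]
  congr 1
  refine card_nbij' (fun p => p.1.inf + K * (p.2.inf + K * (p.1.sup + K * p.2.sup)))
    (fun r => (s((quad K r).1, (quad K r).2.2.1), s((quad K r).2.1, (quad K r).2.2.2))) ?_ ?_ ?_ ?_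
  · rintro ⟨e, f⟩ h
    simp only [coe_filter, mem_product, Set.mem_ofPred_eq] at h
    obtain ⟨⟨he, hf⟩, h⟩ := h
    obtain ⟨he1, he2, he3⟩ := hlt e he
    obtain ⟨hf1, hf2, hf3⟩ := hlt f hf
    simp only [coe_filter, Set.mem_ofPred_eq, mem_range]
    refine ⟨?_, ?_⟩
    · have h1 : e.sup + K * f.sup < K * K := by nlinarith
      have h2 : f.inf + K * (e.sup + K * f.sup) < K * (K * K) := by nlinarith
      have h3 : K ^ 4 = K * (K * (K * K)) := by ring
      rw [h3]
      nlinarith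
    · rw [quad_encode he1 hf1 he2]
      exact ⟨h, by simpa [he3] using he, by simpa [hf3] using hf⟩
  · intro r h
    simp only [coe_filter, Set.mem_ofPred_eq, mem_range] at h
    obtain ⟨-, ⟨h1, h2, h3⟩, he, hf⟩ := h
    simp only [coe_filter, mem_product, Set.mem_ofPred_eq]
    refine ⟨⟨he, hf⟩, ?_⟩
    simp only [Cross, Sym2.inf_mk, Sym2.sup_mk, inf_eq_left.2 (h1.trans h2).le,
      inf_eq_left.2 (h2.trans h3).le, sup_eq_right.2 (h1.trans h2).le,
      sup_eq_right.2 (h2.trans h3).le]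
    exact ⟨h1, h2, h3⟩
  · rintro ⟨e, f⟩ h
    simp only [coe_filter, mem_product, Set.mem_ofPred_eq] at h
    obtain ⟨⟨he, hf⟩, h⟩ := h
    obtain ⟨he1, he2, he3⟩ := hlt e he
    obtain ⟨hf1, hf2, hf3⟩ := hlt f hf
    simp only [quad_encode he1 hf1 he2, he3, hf3]
  · intro r h
    simp only [coe_filter, Set.mem_ofPred_eq, mem_range] at h
    obtain ⟨-, ⟨h1, h2, h3⟩, he, hf⟩ := h
    simp only [Sym2.inf_mk, Sym2.sup_mk, inf_eq_left.2 (h1.trans h2).le,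
      inf_eq_left.2 (h2.trans h3).le, sup_eq_right.2 (h1.trans h2).le,
      sup_eq_right.2 (h2.trans h3).le]
    exact encode_quad K r

/-- The matrix `A` with those entries made zero that would match `a` or `b`, except with each
other. -/
def force (a b : ℕ) (A : ℕ → ℕ → R) (u v : ℕ) : R :=
  if (u = a ∧ v = b) ∨ ¬ (((u = a ∨ u = b) ∨ v = a) ∨ v = b) then A u v else 0

/-- If `a` is matched to some `c ≠ b`, the factor of that pair has become zero. If `{a, b}` is in
the pairing, no other pair meets `a` or `b` and nothing changes. -/
theorem weight_force {S : Finset ℕ} {M : Finset (Sym2 ℕ)} (hM : M ∈ pairingsOn S) {a b : ℕ}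
    (hab : a < b) (ha : a ∈ S) (A : ℕ → ℕ → R) :
    weight (force a b A) M = if s(a, b) ∈ M then weight A M else 0 := by
  have hM' := mem_pairingsOn.1 hM
  split_ifs with h
  · refine prod_congr rfl fun e he => ?_
    rw [force, if_pos]
    have hb := (hM'.1 _ h).2 b (by simp)
    by_cases hae : a ∈ e
    · obtain rfl := (hM'.2 a ha).unique ⟨he, hae⟩ ⟨h, by simp⟩
      exact Or.inl ⟨by simp [hab.le], by simp [hab.le]⟩
    · by_cases hbe : b ∈ e
      · obtain rfl := (hM'.2 b hb).unique ⟨he, hbe⟩ ⟨h, by simp⟩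
        exact absurd (by simp) hae
      · right
        induction e with
        | h c d =>
          simp only [Sym2.mem_iff, not_or] at hae hbe
          rcases le_total c d with h | h <;> simp [h] <;> omega
  · obtain ⟨e, ⟨he, hae⟩, -⟩ := hM'.2 a ha
    refine prod_eq_zero he ?_
    have hd := (hM'.1 e he).1
    obtain ⟨c, rfl⟩ := Sym2.mem_iff_exists.1 hae
    have hcb : c ≠ b := fun hc => h (hc ▸ he)
    have hac : a ≠ c := by simpa using hd
    rw [force, if_neg]
    rcases le_total a c with h | h <;> simp [h] <;> omega

/-- The sum of the weights of all pairings of `{0, …, K - 1}`, each with a sign according to its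
crossings at quadruples with number at least `r`. -/
def partialHafnian (K r : ℕ) (A : ℕ → ℕ → R) : R :=
  ∑ M ∈ pairingsOn (range K), ((crossSign M *
    ∏ q ∈ range r, if CrossAt (quad K q) M then -1 else 1 : ℤ) : R) * weight A M

theorem partialHafnian_zero (K : ℕ) (A : ℕ → ℕ → R) :
    partialHafnian K 0 A = pfaffian A (range K) := by
  simp [partialHafnian, pfaffian]

theorem partialHafnian_pow (K : ℕ) (A : ℕ → ℕ → R) :
    partialHafnian K (K ^ 4) A = hafnianOn A (range K) := by
  refine sum_congr rfl fun M hM => ?_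
  rw [crossSign_eq_prod hM, ← prod_mul_distrib, prod_congr rfl (g := fun _ => (1 : ℤ))]
  · simp
  · intro r _
    split_ifs <;> simp

/-- The matrix `A` with all pairings made zero that do not contain the two crossing pairs which
the quadruple defines. -/
def forceQuad (q : ℕ × ℕ × ℕ × ℕ) (A : ℕ → ℕ → R) : ℕ → ℕ → R :=
  force q.1 q.2.2.1 (force q.2.1 q.2.2.2 A)

/-- Dropping one place multiplies the sign of a pairing by `1 - 2c`, where `c` is `1` if the pairing
crosses there and `0` otherwise. The forced matrix retains precisely the pairings with `c = 1`. -/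
theorem partialHafnian_succ {K r : ℕ} (hr : r < K ^ 4) (A : ℕ → ℕ → R) :
    partialHafnian K (r + 1) A = partialHafnian K r A -
      2 * if Increasing (quad K r) then partialHafnian K r (forceQuad (quad K r) A) else 0 := by
  have hK : 0 < K := by
    rcases Nat.eq_zero_or_pos K with rfl | h
    · simp at hr
    · exact h
  simp only [partialHafnian]
  split_ifs with h
  · rw [mul_sum, ← sum_sub_distrib]
    refine sum_congr rfl fun M hM => ?_
    rw [prod_range_succ, forceQuad, weight_force hM (h.1.trans h.2.1)
      (mem_range.2 (Nat.mod_lt _ hK)), weight_force hM (h.2.1.trans h.2.2)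
      (mem_range.2 (Nat.mod_lt _ hK))]
    by_cases h1 : s((quad K r).1, (quad K r).2.2.1) ∈ M <;>
    by_cases h2 : s((quad K r).2.1, (quad K r).2.2.2) ∈ M <;>
    simp [CrossAt, h, h1, h2]
    ring
  · rw [mul_zero, sub_zero]
    refine sum_congr rfl fun M hM => ?_
    rw [prod_range_succ, if_neg fun h' : CrossAt _ M => h h'.1, mul_one]

/-- An approximation of `partialHafnian K r A` modulo `2 ^ b`. -/
def hafnianApprox (K : ℕ) : ℕ → ℕ → (ℕ → ℕ → R) → R
  | 0, b, A => if b = 0 then 0 else pfaffian A (range K)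
  | r + 1, b, A => if b = 0 then 0 else hafnianApprox K r b A -
      2 * if Increasing (quad K r) then hafnianApprox K r (b - 1) (forceQuad (quad K r) A) else 0

theorem hafnianApprox_succ {K r b : ℕ} (hb : b ≠ 0) (A : ℕ → ℕ → R) :
    hafnianApprox K (r + 1) b A = hafnianApprox K r b A -
      2 * if Increasing (quad K r) then hafnianApprox K r (b - 1) (forceQuad (quad K r) A) else 0 := by
  rw [hafnianApprox, if_neg hb]

/-- The factor `2` in front of the second branch restores the bit of precision that this branch
gives up. -/
theorem two_pow_dvd_sub_hafnianApprox {K r : ℕ} (hr : r ≤ K ^ 4) (b : ℕ) (A : ℕ → ℕ → R) :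
    2 ^ b ∣ partialHafnian K r A - hafnianApprox K r b A := by
  induction r generalizing b A with
  | zero =>
    rw [hafnianApprox, partialHafnian_zero]
    split_ifs with h
    · simp [h]
    · simp
  | succ r ih =>
    rw [partialHafnian_succ hr]
    rcases b with _ | b
    · simp
    · rw [hafnianApprox_succ (by omega : b + 1 ≠ 0), Nat.add_sub_cancel]
      have h1 := ih (Nat.le_of_succ_le hr) (b + 1) A
      split_ifs
      · have h2 := mul_dvd_mul_left 2 (ih (Nat.le_of_succ_le hr) b (forceQuad (quad K r) A))
        rw [← pow_succ'] at h2
        convert dvd_sub h1 h2 using 1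
        ring
      · simpa using h1

theorem hafnianOn_eq_hafnian {K : ℕ} (A : Matrix (Fin K) (Fin K) R) (A' : ℕ → ℕ → R)
    (h : ∀ i j : Fin K, A' i j = A i j) : hafnianOn A' (range K) = hafnian A := by
  have hr : range K = (univ : Finset (Fin K)).map (Fin.valOrderEmb K).toEmbedding := by
    ext x
    simp only [mem_range, mem_map, mem_univ, true_and]
    exact ⟨fun h => ⟨⟨x, h⟩, rfl⟩, fun ⟨y, hy⟩ => hy ▸ y.2⟩
  rw [hr, hafnianOn_map, hafnian, hafnianOn, pairingsOn_univ]
  refine sum_congr rfl fun M _ => prod_congr rfl fun e _ => h _ _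

end Expansion

end Haf

/-! ### Division-free recursion for the Pfaffian -/

namespace Haf

open Finset Polynomial

section Deformation

variable {R : Type*} [CommRing R]

theorem pfaffian_map {V R' : Type*} [LinearOrder V] [CommRing R'] (f : R →+* R') (A : V → V → R)
    (A' : V → V → R') (h : ∀ i j, i < j → f (A i j) = A' i j) (S : Finset V) :
    f (pfaffian A S) = pfaffian A' S := by
  rw [pfaffian, pfaffian, map_sum]
  refine sum_congr rfl fun M hM => ?_
  rw [map_mul, map_intCast, weight, weight, map_prod]
  congr 1
  refine prod_congr rfl fun e he => ?_
  have := ((mem_pairingsOn.1 hM).1 e he).1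
  induction e with
  | h a b =>
    refine h _ _ ?_
    have hab : a ≠ b := by simpa using this
    simpa using hab.symm

/-- The alternating matrix with entries `A i j` above the diagonal. -/
def skew (A : ℕ → ℕ → R) (i j : ℕ) : R := if i < j then A i j else if j < i then -A j i else 0

/-- The matrix `A` above the diagonal, deformed by a multiple of the standard symplectic matrix. -/
noncomputable def deform (A : ℕ → ℕ → R) (i j : ℕ) : R[X] :=
  if i < j then C (A i j) + (if i % 2 = 0 ∧ j = i + 1 then X else 0) else 0

theorem deform_of_lt (A : ℕ → ℕ → R) (i j : ℕ) (h : j < i) : deform A i j = 0 :=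
  if_neg (by omega)

theorem natDegree_deform_le (A : ℕ → ℕ → R) (i j : ℕ) : (deform A i j).natDegree ≤ 1 := by
  rw [deform]
  split_ifs
  · exact (natDegree_add_le _ _).trans (max_le (by simp) natDegree_X_le)
  · simp
  · simp

/-- Twice the true bound, but enough to give the descent in the degree a starting point. -/
theorem natDegree_pfaffian_le (A : ℕ → ℕ → R) (S : Finset ℕ) :
    (pfaffian (deform A) S).natDegree ≤ S.card := by
  induction h : S.card using Nat.strong_induction_on generalizing S with
  | _ n ih =>
    subst h
    rcases S.eq_empty_or_nonempty with rfl | hS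
    · simp [pfaffian_empty]
    · have hm := S.min'_mem hS
      have hv : ∀ w ∈ S.erase (S.min' hS), S.min' hS < w :=
        fun w hw => S.min'_lt_of_mem_erase_min' hS hw
      have hc := card_erase_add_one hm
      generalize S.min' hS = v at *
      conv_lhs => rw [← insert_erase hm, pfaffian_insert _ hv]
      refine natDegree_sum_le_of_forall_le _ _ fun w hw => ?_
      have hw' := card_erase_add_one hw
      have h1 := ih _ (by omega) ((S.erase v).erase w) rfl
      have h2 : ∀ k : ℕ, ((-1) ^ k : R[X]).natDegree ≤ 0 := fun k => by
        rcases neg_one_pow_eq_or R[X] k with h | h <;> simp [h]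
      refine natDegree_mul_le.trans ?_
      refine (Nat.add_le_add (natDegree_mul_le.trans (Nat.add_le_add (h2 _)
        (natDegree_deform_le A v w))) h1).trans ?_
      omega

theorem deform_sub (A : ℕ → ℕ → R) (i j : ℕ) :
    deform A i j - deform A j i = C (skew A i j) + ((if i % 2 = 0 ∧ j = i + 1 then X else 0) -
      if j % 2 = 0 ∧ i = j + 1 then X else 0) := by
  rcases lt_trichotomy i j with h | rfl | h
  · have h2 : ¬ j < i := by omega
    have h3 : ¬ (j % 2 = 0 ∧ i = j + 1) := by omega
    simp only [deform, skew, if_pos h, if_neg h2, if_neg h3, sub_zero]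
  · simp [skew]
  · have h2 : ¬ i < j := by omega
    have h3 : ¬ (i % 2 = 0 ∧ j = i + 1) := by omega
    simp only [deform, skew, if_pos h, if_neg h2, if_neg h3, C_neg]
    ring

/-- The coefficients of the Pfaffian of the last rows and columns of the deformed matrix. -/
noncomputable def pfCoeff (A : ℕ → ℕ → R) (K a d : ℕ) : R :=
  (pfaffian (deform A) (Ico a K)).coeff d

/-- The coefficients of the cofactors that border the last rows and columns by row `a - 1`. -/
noncomputable def cofCoeff (A : ℕ → ℕ → R) (K a d i : ℕ) : R :=
  if a ≤ i then (cofactor (deform A) (a - 1) (Ico a K) i).coeff d else 0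

theorem sum_cofCoeff (A : ℕ → ℕ → R) (K a d : ℕ) (f : ℕ → R) :
    ∑ i ∈ Ico a K, f i * (cofactor (deform A) (a - 1) (Ico a K) i).coeff d =
      ∑ i ∈ range K, f i * cofCoeff A K a d i := by
  have hsub : Ico a K ⊆ range K := fun i hi => mem_range.2 (mem_Ico.1 hi).2
  rw [← sum_subset hsub]
  · refine sum_congr rfl fun i hi => ?_
    rw [cofCoeff, if_pos (mem_Ico.1 hi).1]
  · intro i hi hi'
    rw [cofCoeff, if_neg, mul_zero]
    rw [mem_Ico] at hi'
    have := mem_range.1 hi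
    omega

theorem pfCoeff_self (A : ℕ → ℕ → R) (K d : ℕ) :
    pfCoeff A K K d = if d = 0 then 1 else 0 := by
  rw [pfCoeff, Ico_self, pfaffian_empty, coeff_one]

theorem pfCoeff_zero_zero (A : ℕ → ℕ → R) (K : ℕ) :
    pfCoeff A K 0 0 = pfaffian A (range K) := by
  rw [pfCoeff, ← Nat.Ico_zero_eq_range, ← constantCoeff_apply]
  refine pfaffian_map (constantCoeff : R[X] →+* R) _ _ (fun i j h => ?_) _
  rw [deform, if_pos h]
  split_ifs <;> simp

/-- The start of the descent: these cofactors are Pfaffians of sets with at most `K` elements, up to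
sign. -/
theorem cofCoeff_of_lt (A : ℕ → ℕ → R) {K a d : ℕ} (ha : 0 < a) (hd : K < d) {i : ℕ} (hi : i < K) :
    cofCoeff A K a d i = 0 := by
  rw [cofCoeff]
  split_ifs with h
  · have hv : ∀ w ∈ Ico a K, a - 1 < w := fun w hw => by
      have := (mem_Ico.1 hw).1
      omega
    rw [cofactor_eq _ (deform_of_lt A) hv]
    refine coeff_eq_zero_of_natDegree_lt (lt_of_le_of_lt ?_ hd)
    have hi' : i ∈ Ico a K := mem_Ico.2 ⟨h, hi⟩
    have h1 := natDegree_pfaffian_le A (insert (a - 1) ((Ico a K).erase i))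
    have h2 := card_insert_le (a - 1) ((Ico a K).erase i)
    have h3 := card_erase_add_one hi'
    rw [Nat.card_Ico] at h3
    have h4 : ∀ k : ℕ, ((-1) ^ k : R[X]).natDegree ≤ 0 := fun k => by
      rcases neg_one_pow_eq_or R[X] k with h | h <;> simp [h]
    refine natDegree_mul_le.trans ((Nat.add_le_add (h4 _) h1).trans ?_)
    omega
  · rfl

/-- The residual of row `u` of the linear system for the cofactors. -/
noncomputable def residual (A : ℕ → ℕ → R) (K a d u : ℕ) : R :=
  skew A u (a - 1) * pfCoeff A K a d - ∑ j ∈ range K, skew A u j * cofCoeff A K a d j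

/-- The system for the cofactors has matrix `skew A + X J`, and each row of `J` has a single entry
`±1`, at the partner of its index. The coefficient of `X ^ (d + 1)` in the partner's row thus
isolates the cofactor at `i` in degree `d`, and all other terms have degree `d + 1`. -/
theorem cofCoeff_rec (A : ℕ → ℕ → R) {K a d i : ℕ} (hK : K % 2 = 0) (ha : a % 2 = 0) (ha' : 0 < a)
    (hi : i < K) :
    cofCoeff A K a d i = if i < a then 0 else
      if i % 2 = 0 then -residual A K a (d + 1) (i + 1) else residual A K a (d + 1) (i - 1) := by
  simp only [residual]
  split_ifs with h h2
  · rw [cofCoeff, if_neg (by omega)]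
  · have hu : i + 1 ∈ Ico a K := mem_Ico.2 ⟨by omega, by omega⟩
    have hii : i ∈ Ico a K := mem_Ico.2 ⟨by omega, hi⟩
    have key := congr_arg (fun p => coeff p (d + 1))
      (sum_mul_cofactor (deform A) (deform_of_lt A) (v := a - 1) hu)
    simp only [deform_sub, add_mul, sum_add_distrib, coeff_add, finsetSum_coeff, coeff_C_mul] at key
    -- Row `i + 1` of `X J` contains only `-X`, in column `i`. On the right-hand side `J` does not
    -- contribute: the partner of `a - 1` is `a - 2`, outside the range.
    rw [sum_cofCoeff, sum_eq_single_of_mem i hii, if_neg (by omega), if_pos ⟨h2, rfl⟩,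
      if_neg (by omega), if_neg (by omega), sub_zero, zero_mul, coeff_zero, zero_sub, neg_mul,
      coeff_neg, coeff_X_mul] at key
    · rw [cofCoeff, if_pos (by omega), pfCoeff]
      linear_combination -key
    · intro j _ hj
      rw [if_neg (by omega), if_neg (by omega), sub_zero, zero_mul, coeff_zero]
  · have hu : i - 1 ∈ Ico a K := mem_Ico.2 ⟨by omega, by omega⟩
    have hii : i ∈ Ico a K := mem_Ico.2 ⟨by omega, hi⟩
    have key := congr_arg (fun p => coeff p (d + 1))
      (sum_mul_cofactor (deform A) (deform_of_lt A) (v := a - 1) hu)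
    simp only [deform_sub, add_mul, sum_add_distrib, coeff_add, finsetSum_coeff, coeff_C_mul] at key
    rw [sum_cofCoeff, sum_eq_single_of_mem i hii, if_pos (by omega), if_neg (by omega),
      if_neg (by omega), if_neg (by omega), sub_zero, sub_zero, zero_mul, coeff_zero,
      coeff_X_mul] at key
    · rw [cofCoeff, if_pos (by omega), pfCoeff]
      linear_combination key
    · intro j _ hj
      rw [if_neg (by omega), if_neg (by omega), sub_zero, zero_mul, coeff_zero]

/-- The rows `a - 2` and `a - 1` are partners, so `X` occurs only in the entry joining them; it
causes the shift from `d` to `d - 1`. -/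
theorem pfCoeff_rec (A : ℕ → ℕ → R) {K a d : ℕ} (ha : a % 2 = 0) (ha' : 0 < a) (haK : a ≤ K) :
    pfCoeff A K (a - 2) d = A (a - 2) (a - 1) * pfCoeff A K a d +
      (if d = 0 then 0 else pfCoeff A K a (d - 1)) -
      ∑ i ∈ range K, A (a - 2) i * cofCoeff A K a d i := by
  have hv : ∀ w ∈ Ico a K, a - 1 < w := fun w hw => by
    have := (mem_Ico.1 hw).1
    omega
  have hins : Ico (a - 2) K = insert (a - 2) (insert (a - 1) (Ico a K)) := by
    ext z
    simp only [mem_insert, mem_Ico]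
    omega
  rw [pfCoeff, hins, pfaffian_insert_insert _ (deform_of_lt A) (by omega) hv, coeff_sub,
    finsetSum_coeff, ← sum_cofCoeff]
  congr 1
  · rw [deform, if_pos (by omega), if_pos ⟨by omega, by omega⟩, add_mul, coeff_add, coeff_C_mul,
      pfCoeff]
    congr 1
    cases d with
    | zero => simp
    | succ d => simp [coeff_X_mul, pfCoeff]
  · refine sum_congr rfl fun i hi => ?_
    have := hv i hi
    rw [deform, if_pos (by omega), if_neg (by omega), add_zero, coeff_C_mul]

end Deformation

end Haf

/-! ### Pfaffians in polynomial time -/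

namespace Lisp

open Polynomial Haf

/-- A square matrix of polynomials, its size and the parameters of the representation can be
computed. -/
structure MatParams {ι : Type} (s : ι → ℕ) (x : ι → Val) (D m K : ι → ℕ)
    (A : ι → ℕ → ℕ → ℤ[X]) : Prop extends Params s x D m where
  size : Cmp s x (fun i => encUnary (K i))
  size_le : PolyBounded K s
  matrix : Cmp s x (fun i => repMatrix (D i) (m i) (K i) (A i))

variable {ι κ : Type} {s : ι → ℕ} {x : ι → Val} {D m K : ι → ℕ} {A : ι → ℕ → ℕ → ℤ[X]}

namespace MatParams

theorem up (h : MatParams s x D m K A) (φ : κ → ι) (w : κ → Val) :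
    MatParams (fun p => s (φ p)) (fun p => .cons (x (φ p)) (w p)) (fun p => D (φ p))
      (fun p => m (φ p)) (fun p => K (φ p)) (fun p => A (φ p)) :=
  ⟨h.toParams.up φ w, h.size.up φ w, h.size_le.comp φ, h.matrix.up φ w⟩

theorem entry (h : MatParams s x D m K A) {u v : ι → ℕ}
    (hu : Cmp s x (fun i => encUnary (u i))) (hv : Cmp s x (fun i => encUnary (v i)))
    (hu' : ∀ i, u i < K i) (hv' : ∀ i, v i < K i) :
    Cmp s x (fun i => rep (D i) (m i) (A i (u i) (v i))) :=
  Cmp.entry h.matrix h.size_le hu hv hu' hv'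

theorem skew (h : MatParams s x D m K A) {u v : ι → ℕ}
    (hu : Cmp s x (fun i => encUnary (u i))) (hv : Cmp s x (fun i => encUnary (v i)))
    (hu' : ∀ i, u i < K i) (hv' : ∀ i, v i < K i) :
    Cmp s x (fun i => rep (D i) (m i) (skew (A i) (u i) (v i))) := by
  have bu : PolyBounded u s := h.size_le.mono fun i => (hu' i).le
  have bv : PolyBounded v s := h.size_le.mono fun i => (hv' i).le
  have h1 := Cmp.ite (p := fun i => v i < u i) (Cmp.lt hv hu bu)
    (Cmp.rep_neg h.toParams (h.entry hv hu hv' hu')) (Cmp.rep_zero h.toParams)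
  have h2 := Cmp.ite (p := fun i => u i < v i) (Cmp.lt hu hv bv) (h.entry hu hv hu' hv') h1
  refine h2.congr fun i => ?_
  rw [Haf.skew]
  split_ifs <;> rfl

end MatParams

/-- The representation of a finite sequence of polynomials. -/
def repList (D m n : ℕ) (c : ℕ → ℤ[X]) : Val := encList ((List.range n).map fun j => rep D m (c j))

namespace Cmp

theorem rep_getD {n : ι → ℕ} {c : ι → ℕ → ℤ[X]} {j : ι → ℕ}
    (hc : Cmp s x (fun i => repList (D i) (m i) (n i) (c i)))
    (hj : Cmp s x (fun i => encUnary (j i))) (hb : PolyBounded n s) (hj' : ∀ i, j i < n i) :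
    Cmp s x (fun i => rep (D i) (m i) (c i (j i))) :=
  getD_range (v := fun i j => rep (D i) (m i) (c i j)) hc hj hb hj'

theorem rep_dot {n : ι → ℕ} {f c : ι → ℕ → ℤ[X]} (h : Params s x D m)
    (hn : Cmp s x (fun i => encUnary (n i))) (hb : PolyBounded n s)
    (hf : Cmp (fun p : Σ i, Fin (n i) => s p.1) (fun p => .cons (x p.1) (encUnary p.2))
      (fun p => rep (D p.1) (m p.1) (f p.1 p.2)))
    (hc : Cmp s x (fun i => repList (D i) (m i) (n i) (c i))) :
    Cmp s x (fun i => rep (D i) (m i) (∑ j ∈ Finset.range (n i), f i j * c i j)) :=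
  rep_sum h hn hb (rep_mul (h.up _ _) hf
    (rep_getD (n := fun p : Σ i, Fin (n i) => n p.1) (hc.up _ _) last (hb.comp _) fun p => p.2.2))

theorem skew_dot {u : ι → ℕ} {c : ι → ℕ → ℤ[X]} (h : MatParams s x D m K A)
    (hu : Cmp s x (fun i => encUnary (u i))) (hu' : ∀ i, u i < K i)
    (hc : Cmp s x (fun i => repList (D i) (m i) (K i) (c i))) :
    Cmp s x (fun i => rep (D i) (m i)
      (∑ j ∈ Finset.range (K i), skew (A i) (u i) j * c i j)) :=
  rep_dot h.toParams h.size h.size_le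
    ((h.up (Sigma.fst : (Σ i, Fin (K i)) → ι) _).skew (hu.up _ _) last (fun _ => hu' _)
      fun p => p.2.2) hc

theorem rep_residual {a d u : ι → ℕ} (h : MatParams s x D m K A)
    (ca : Cmp s x (fun i => encUnary (a i))) (ha' : ∀ i, 0 < a i) (haK : ∀ i, a i ≤ K i)
    (hu : Cmp s x (fun i => encUnary (u i))) (hu' : ∀ i, u i < K i)
    (hp : Cmp s x (fun i => rep (D i) (m i) (pfCoeff (A i) (K i) (a i) (d i))))
    (hc : Cmp s x (fun i => repList (D i) (m i) (K i) (cofCoeff (A i) (K i) (a i) (d i)))) :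
    Cmp s x (fun i => rep (D i) (m i) (residual (A i) (K i) (a i) (d i) (u i))) :=
  rep_sub h.toParams (rep_mul h.toParams (h.skew hu (pred ca) hu' fun i => by
    have := ha' i
    have := haK i
    omega) hp) (skew_dot h hu hu' hc)

theorem cofCoeff_step {a d : ι → ℕ} (h : MatParams s x D m K A) (hK : ∀ i, K i % 2 = 0)
    (ca : Cmp s x (fun i => encUnary (a i))) (ha : ∀ i, a i % 2 = 0) (ha' : ∀ i, 0 < a i)
    (haK : ∀ i, a i ≤ K i)
    (hp : Cmp s x (fun i => rep (D i) (m i) (pfCoeff (A i) (K i) (a i) (d i + 1))))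
    (hc : Cmp s x (fun i => repList (D i) (m i) (K i) (cofCoeff (A i) (K i) (a i) (d i + 1)))) :
    Cmp s x (fun i => repList (D i) (m i) (K i) (cofCoeff (A i) (K i) (a i) (d i))) := by
  let φ : (Σ i, Fin (K i)) → ι := Sigma.fst
  have h' := h.up φ (fun p => encUnary p.2)
  have ca' := ca.up φ (fun p => encUnary p.2)
  have hj : Cmp (fun p => s (φ p)) (fun p => .cons (x (φ p)) (encUnary p.2))
    (fun p => encUnary p.2) := last
  have hjb : PolyBounded (fun p : Σ i, Fin (K i) => (p.2 : ℕ)) (fun p => s (φ p)) :=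
    (h.size_le.comp φ).mono fun p => p.2.2.le
  have hab : PolyBounded (fun p : Σ i, Fin (K i) => a (φ p)) (fun p => s (φ p)) :=
    (h.size_le.comp φ).mono fun _ => haK _
  have hev := eq_zero (mod hj hjb (unary 2) (.const 2))
  -- This branch is used only for even indices. The dummy row `0` for odd ones keeps the index below
  -- `K`.
  have t1 := rep_neg h'.toParams (rep_residual
    (u := fun p : Σ i, Fin (K i) => if (p.2 : ℕ) % 2 = 0 then (p.2 : ℕ) + 1 else 0)
    (d := fun p => d (φ p) + 1) h' ca' (fun _ => ha' _) (fun _ => haK _)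
    (iteNat hev hj.succ (unary 0)) (fun p => by
      have h1 : K (φ p) % 2 = 0 := hK _
      have h2 : (p.2 : ℕ) < K (φ p) := p.2.2
      split_ifs <;> omega) (hp.up φ _) (hc.up φ _))
  have t2 := rep_residual (u := fun p : Σ i, Fin (K i) => (p.2 : ℕ) - 1)
    (d := fun p => d (φ p) + 1) h' ca' (fun _ => ha' _) (fun _ => haK _) (pred hj)
    (fun p => (Nat.sub_le _ _).trans_lt p.2.2) (hp.up φ _) (hc.up φ _)
  refine tabulate (v := fun i j => rep (D i) (m i) (cofCoeff (A i) (K i) (a i) (d i) j))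
    h.size h.size_le ((ite (lt hj ca' hab) (rep_zero h'.toParams) (ite hev t1 t2)).congr
    fun p => ?_)
  rw [cofCoeff_rec (A p.1) (hK p.1) (ha p.1) (ha' p.1) p.2.2]
  simp only [φ]
  split_ifs <;> rfl

theorem cofCoeff_table {a d : ι → ℕ} (h : MatParams s x D m K A) (hK : ∀ i, K i % 2 = 0)
    (ca : Cmp s x (fun i => encUnary (a i))) (ha : ∀ i, a i % 2 = 0) (ha' : ∀ i, 0 < a i)
    (haK : ∀ i, a i ≤ K i) (cd : Cmp s x (fun i => encUnary (d i))) (hd : ∀ i, d i < K i + 2)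
    (hp : Cmp s x (fun i => repList (D i) (m i) (K i + 2) (pfCoeff (A i) (K i) (a i)))) :
    Cmp s x (fun i => repList (D i) (m i) (K i) (cofCoeff (A i) (K i) (a i) (d i))) := by
  have hb1 : PolyBounded (fun i => K i + 1) s := h.size_le.add (.const 1)
  have hb : PolyBounded (fun i => K i + 2) s := h.size_le.add (.const 2)
  have hdb : PolyBounded d s := hb.mono fun i => (hd i).le
  -- Stage `e` holds the cofactors in degree `K + 1 - e`. They vanish at `e = 0`, and each step
  -- reads the Pfaffian coefficient one degree higher, at most `K + 1`; hence tables of length `K +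
  -- 2`.
  let σ : ι → ℕ → Val := fun i e =>
    repList (D i) (m i) (K i) (cofCoeff (A i) (K i) (a i) (K i + 1 - e))
  have key : Cmp s x (fun i => σ i (K i + 1 - d i)) := by
    refine natrec (sub h.size.succ cd hdb) (hb1.mono fun i => Nat.sub_le _ _) ?_ ?_
    · let φ : (Σ i, Fin (K i)) → ι := Sigma.fst
      refine tabulate (v := fun i j => rep (D i) (m i) (cofCoeff (A i) (K i) (a i) (K i + 1 - 0) j))
        h.size h.size_le ((rep_zero (h.toParams.up φ fun p => encUnary p.2)).congr fun p => ?_)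
      rw [cofCoeff_of_lt (A p.1) (ha' p.1) (by omega) p.2.2]
    · let φ : (Σ i, Fin (K i + 1 - d i)) → ι := Sigma.fst
      have h' := h.up φ (fun p => .cons (encUnary p.2) (σ p.1 p.2))
      have he : Cmp (fun p => s (φ p)) (fun p => .cons (x (φ p)) (.cons (encUnary p.2) (σ p.1 p.2)))
        (fun p => encUnary p.2) := fst (snd id)
      have hσ : Cmp (fun p => s (φ p)) (fun p => .cons (x (φ p)) (.cons (encUnary p.2) (σ p.1 p.2)))
        (fun p => σ p.1 p.2) := snd (snd id)
      have heb : PolyBounded (fun p : Σ i, Fin (K i + 1 - d i) => (p.2 : ℕ)) (fun p => s (φ p)) :=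
        (hb1.comp φ).mono fun p => p.2.2.le.trans (Nat.sub_le _ _)
      have hee : ∀ p : Σ i, Fin (K i + 1 - d i),
          K (φ p) + 1 - (p.2 + 1) + 1 = K (φ p) + 1 - p.2 := fun p => by
        have : (p.2 : ℕ) < K (φ p) + 1 - d (φ p) := p.2.2
        omega
      have hpe := rep_getD (n := fun p => K (φ p) + 2)
        (c := fun p => pfCoeff (A (φ p)) (K (φ p)) (a (φ p)))
        (j := fun p : Σ i, Fin (K i + 1 - d i) => K (φ p) + 1 - p.2)
        (hp.up φ _) (sub h'.size.succ he heb) (hb.comp φ) fun p => by omega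
      exact cofCoeff_step (a := fun p => a (φ p)) (d := fun p => K (φ p) + 1 - (p.2 + 1)) h'
        (fun _ => hK _) (ca.up φ _) (fun _ => ha _) (fun _ => ha' _) (fun _ => haK _)
        (hpe.congr fun p => by rw [hee p]) (hσ.congr fun p => by
          rw [hee p])
  refine key.congr fun i => ?_
  have := hd i
  simp only [σ, show K i + 1 - (K i + 1 - d i) = d i by omega]

theorem pfCoeff_step {a : ι → ℕ} (h : MatParams s x D m K A) (hK : ∀ i, K i % 2 = 0)
    (ca : Cmp s x (fun i => encUnary (a i))) (ha : ∀ i, a i % 2 = 0) (ha' : ∀ i, 0 < a i)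
    (haK : ∀ i, a i ≤ K i)
    (hp : Cmp s x (fun i => repList (D i) (m i) (K i + 2) (pfCoeff (A i) (K i) (a i)))) :
    Cmp s x (fun i => repList (D i) (m i) (K i + 2) (pfCoeff (A i) (K i) (a i - 2))) := by
  have hb : PolyBounded (fun i => K i + 2) s := h.size_le.add (.const 2)
  let φ : (Σ i, Fin (K i + 2)) → ι := Sigma.fst
  have h' := h.up φ (fun p => encUnary p.2)
  have ca' := ca.up φ (fun p => encUnary p.2)
  have hp' := hp.up φ (fun p => encUnary p.2)
  have hd : Cmp (fun p => s (φ p)) (fun p => .cons (x (φ p)) (encUnary p.2))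
    (fun p => encUnary p.2) := last
  have haK' : ∀ p, a (φ p) - 2 < K (φ p) := fun p => by
    have := ha' (φ p)
    have := haK (φ p)
    omega
  have haK'' : ∀ p, a (φ p) - 1 < K (φ p) := fun p => by
    have := ha' (φ p)
    have := haK (φ p)
    omega
  have ca2 : Cmp (fun p => s (φ p)) (fun p => .cons (x (φ p)) (encUnary p.2))
    (fun p => encUnary (a (φ p) - 2)) := pred (pred ca')
  have t1 := rep_getD (n := fun p => K (φ p) + 2) (j := fun p : Σ i, Fin (K i + 2) => (p.2 : ℕ))
    (c := fun p => pfCoeff (A (φ p)) (K (φ p)) (a (φ p))) hp' hd (hb.comp φ) fun p => p.2.2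
  have t2 := rep_getD (n := fun p => K (φ p) + 2) (j := fun p : Σ i, Fin (K i + 2) => (p.2 : ℕ) - 1)
    (c := fun p => pfCoeff (A (φ p)) (K (φ p)) (a (φ p))) hp' (pred hd) (hb.comp φ)
    fun p => (Nat.sub_le _ _).trans_lt p.2.2
  have t3 := cofCoeff_table (d := fun p : Σ i, Fin (K i + 2) => (p.2 : ℕ)) h' (fun _ => hK _) ca'
    (fun _ => ha _) (fun _ => ha' _) (fun _ => haK _) hd (fun p => p.2.2) hp'
  let ψ : (Σ p : (Σ i, Fin (K i + 2)), Fin (K (φ p))) → (Σ i, Fin (K i + 2)) := Sigma.fst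
  have t4 := (h'.up ψ (fun p => encUnary p.2)).entry (u := fun p => a (φ (ψ p)) - 2)
    (v := fun p => p.2) (ca2.up ψ _) last (fun _ => haK' _) fun p => p.2.2
  have t5 := rep_dot (f := fun p j => A (φ p) (a (φ p) - 2) j) h'.toParams h'.size h'.size_le t4 t3
  have t6 : Cmp (fun p => s (φ p)) (fun p => .cons (x (φ p)) (encUnary p.2)) (fun p =>
      rep (D (φ p)) (m (φ p)) (if (p.2 : ℕ) = 0 then 0 else
        pfCoeff (A (φ p)) (K (φ p)) (a (φ p)) (p.2 - 1))) :=
    (ite (eq_zero hd) (rep_zero h'.toParams) t2).congr fun p => by split_ifs <;> rfl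
  have t7 := rep_mul h'.toParams (h'.entry ca2 (pred ca') haK' haK'') t1
  refine tabulate (v := fun i d => rep (D i) (m i) (pfCoeff (A i) (K i) (a i - 2) d))
    h.size.succ.succ hb ((rep_sub h'.toParams (rep_add h'.toParams t7 t6) t5).congr fun p => ?_)
  rw [pfCoeff_rec (A p.1) (ha p.1) (ha' p.1) (haK p.1)]

theorem rep_pfaffian {n : ι → ℕ} (h : MatParams s x D m K A)
    (hn : Cmp s x (fun i => encUnary (n i))) (hK : ∀ i, K i = 2 * n i) :
    Cmp s x (fun i => rep (D i) (m i) (pfaffian (A i) (Finset.range (K i)))) := by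
  have hb : PolyBounded (fun i => K i + 2) s := h.size_le.add (.const 2)
  have hnb : PolyBounded n s := h.size_le.mono fun i => by
    have := hK i
    omega
  -- Stage `t` treats the last `2t` rows and columns, beginning with the empty Pfaffian `1`.
  let σ : ι → ℕ → Val := fun i t =>
    repList (D i) (m i) (K i + 2) (pfCoeff (A i) (K i) (K i - 2 * t))
  have key : Cmp s x (fun i => σ i (n i)) := by
    refine natrec hn hnb ?_ ?_
    · let φ : (Σ i, Fin (K i + 2)) → ι := Sigma.fst
      have h' := h.up φ (fun p => encUnary p.2)
      have hd : Cmp (fun p => s (φ p)) (fun p => .cons (x (φ p)) (encUnary p.2))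
        (fun p => encUnary p.2) := last
      refine tabulate (v := fun i d => rep (D i) (m i) (pfCoeff (A i) (K i) (K i - 2 * 0) d))
        h.size.succ.succ hb ((ite (eq_zero hd) (rep_one h'.toParams)
          (rep_zero h'.toParams)).congr fun p => ?_)
      rw [Nat.mul_zero, Nat.sub_zero, pfCoeff_self]
      split_ifs <;> rfl
    · let φ : (Σ i, Fin (n i)) → ι := Sigma.fst
      have h' := h.up φ (fun p => .cons (encUnary p.2) (σ p.1 p.2))
      have hj : PolyBounded (fun p : Σ i, Fin (n i) => (p.2 : ℕ)) (fun p => s (φ p)) :=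
        (hnb.comp φ).mono fun p => p.2.2.le
      have he : Cmp (fun p => s (φ p)) (fun p => .cons (x (φ p)) (.cons (encUnary p.2) (σ p.1 p.2)))
        (fun p => encUnary p.2) := fst (snd id)
      have hσ : Cmp (fun p => s (φ p)) (fun p => .cons (x (φ p)) (.cons (encUnary p.2) (σ p.1 p.2)))
        (fun p => σ p.1 p.2) := snd (snd id)
      have hlt : ∀ p : Σ i, Fin (n i), (p.2 : ℕ) < n (φ p) := fun p => p.2.2
      refine (pfCoeff_step (a := fun p => K (φ p) - 2 * p.2) h' (fun p => ?_)
        (sub h'.size (mul (unary 2) (.const 2) he hj) ((PolyBounded.const 2).mul hj))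
        (fun p => ?_) (fun p => ?_) (fun p => Nat.sub_le _ _) hσ).congr fun p => ?_
      · have := hK (φ p)
        omega
      · have := hK (φ p)
        omega
      · have := hK (φ p)
        have := hlt p
        omega
      · rw [Nat.sub_sub, ← Nat.mul_succ]
  refine (rep_getD (n := fun i => K i + 2) (c := fun i => pfCoeff (A i) (K i) (K i - 2 * n i))
    (j := fun _ => 0) key (unary 0) hb fun i => by omega).congr fun i => ?_
  rw [hK i, Nat.sub_self, pfCoeff_zero_zero]

end Cmp

end Lisp

/-! ### The recursion tree for the hafnian -/

namespace Lisp

open Polynomial Haf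

variable {ι κ : Type} {s : ι → ℕ} {x : ι → Val} {D m K : ι → ℕ} {A : ι → ℕ → ℕ → ℤ[X]}

namespace MatParams

theorem force (h : MatParams s x D m K A) {a b : ι → ℕ} (ca : Cmp s x (fun i => encUnary (a i)))
    (ha : PolyBounded a s) (cb : Cmp s x (fun i => encUnary (b i))) (hb : PolyBounded b s) :
    MatParams s x D m K (fun i => force (a i) (b i) (A i)) := by
  refine { h with matrix := ?_ }
  let φ : (Σ p : (Σ i, Fin (K i)), Fin (K p.1)) → (Σ i, Fin (K i)) := Sigma.fst
  let ψ : (Σ i, Fin (K i)) → ι := Sigma.fst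
  have h' := (h.up ψ (fun p => encUnary p.2)).up φ (fun p => encUnary p.2)
  have ca' := (ca.up ψ (fun p => encUnary p.2)).up φ (fun p => encUnary p.2)
  have cb' := (cb.up ψ (fun p => encUnary p.2)).up φ (fun p => encUnary p.2)
  have ha' := (ha.comp ψ).comp φ
  have hb' := (hb.comp ψ).comp φ
  have cu : Cmp (fun p => s (ψ (φ p)))
    (fun p => .cons (.cons (x (ψ (φ p))) (encUnary (φ p).2)) (encUnary p.2))
    (fun p => encUnary p.1.2) := .snd (.fst .id)
  have cv : Cmp (fun p => s (ψ (φ p)))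
    (fun p => .cons (.cons (x (ψ (φ p))) (encUnary (φ p).2)) (encUnary p.2))
    (fun p => encUnary p.2) := .last
  have bu : PolyBounded (fun p : Σ p : (Σ i, Fin (K i)), Fin (K p.1) => (p.1.2 : ℕ))
    (fun p => s (ψ (φ p))) := ((h.size_le.comp ψ).comp φ).mono fun p => p.1.2.2.le
  have bv : PolyBounded (fun p : Σ p : (Σ i, Fin (K i)), Fin (K p.1) => (p.2 : ℕ))
    (fun p => s (ψ (φ p))) := ((h.size_le.comp ψ).comp φ).mono fun p => p.2.2.le
  have hc := Cmp.or (Cmp.and (Cmp.eq cu bu ca' ha') (Cmp.eq cv bv cb' hb'))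
    (Cmp.not (Cmp.or (Cmp.or (Cmp.or (Cmp.eq cu bu ca' ha') (Cmp.eq cu bu cb' hb'))
      (Cmp.eq cv bv ca' ha')) (Cmp.eq cv bv cb' hb')))
  refine Cmp.repMatrix_of_entry h.size h.size_le ((Cmp.ite hc
    (h'.entry cu cv (fun p => p.1.2.2) fun p => p.2.2) (Cmp.rep_zero h'.toParams)).congr fun p => ?_)
  rw [Haf.force]
  simp only [φ, ψ]
  split_ifs <;> rfl

end MatParams

namespace Cmp

variable {r : ι → ℕ}

theorem quad_fst (hK : Cmp s x (fun i => encUnary (K i))) (hKb : PolyBounded K s)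
    (hr : Cmp s x (fun i => encUnary (r i))) (hb : PolyBounded r s) :
    Cmp s x (fun i => encUnary (quad (K i) (r i)).1) := mod hr hb hK hKb

theorem quad_snd (hK : Cmp s x (fun i => encUnary (K i))) (hKb : PolyBounded K s)
    (hr : Cmp s x (fun i => encUnary (r i))) (hb : PolyBounded r s) :
    Cmp s x (fun i => encUnary (quad (K i) (r i)).2.1) :=
  mod (div hr hb hK hKb) (hb.mono fun _ => Nat.div_le_self _ _) hK hKb

theorem quad_thd (hK : Cmp s x (fun i => encUnary (K i))) (hKb : PolyBounded K s)
    (hr : Cmp s x (fun i => encUnary (r i))) (hb : PolyBounded r s) :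
    Cmp s x (fun i => encUnary (quad (K i) (r i)).2.2.1) :=
  quad_snd (r := fun i => r i / K i) hK hKb (div hr hb hK hKb) (hb.mono fun _ => Nat.div_le_self _ _)

theorem quad_fth (hK : Cmp s x (fun i => encUnary (K i))) (hKb : PolyBounded K s)
    (hr : Cmp s x (fun i => encUnary (r i))) (hb : PolyBounded r s) :
    Cmp s x (fun i => encUnary (quad (K i) (r i)).2.2.2) := by
  have h1 : PolyBounded (fun i => r i / K i) s := hb.mono fun _ => Nat.div_le_self _ _
  have h2 : PolyBounded (fun i => r i / K i / K i) s := h1.mono fun _ => Nat.div_le_self _ _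
  exact div (div (div hr hb hK hKb) h1 hK hKb) h2 hK hKb

end Cmp

theorem quad_le (K r : ℕ) : (quad K r).1 ≤ r ∧ (quad K r).2.1 ≤ r ∧ (quad K r).2.2.1 ≤ r ∧
    (quad K r).2.2.2 ≤ r := by
  have h1 := Nat.div_le_self r K
  have h2 := Nat.div_le_self (r / K) K
  have h3 := Nat.div_le_self (r / K / K) K
  have h4 := Nat.mod_le (r / K) K
  have h5 := Nat.mod_le (r / K / K) K
  exact ⟨Nat.mod_le _ _, h4.trans h1, (h5.trans h2).trans h1, (h3.trans h2).trans h1⟩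

/-- The arguments of the recursive calls of `hafnianApprox`. -/
structure Node {ι : Type} (K k : ι → ℕ) where
  /-- the input -/
  base : ι
  /-- the current matrix -/
  mat : ℕ → ℕ → ℤ[X]
  /-- the number of quadruples left -/
  r : ℕ
  /-- the precision -/
  b : ℕ
  r_le : r ≤ K base ^ 4
  b_le : b ≤ k base

namespace Cmp

/-- Each node carries the original input, which fixes the size measure, together with the current
matrix, the number of quadruples left and the precision. -/
theorem rep_hafnianApprox {n k : ι → ℕ} (h : MatParams s x D m K A)
    (hn : Cmp s x (fun i => encUnary (n i))) (hK : ∀ i, K i = 2 * n i)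
    (hk : Cmp s x (fun i => encUnary (k i)))
    (hb : PolyBounded (fun i => (K i ^ 4 + 1) ^ k i) s) :
    Cmp s x (fun i => rep (D i) (m i) (hafnianApprox (K i) (K i ^ 4) (k i) (A i))) := by
  let τ := Node K k
  let φ : τ → ι := Node.base
  let w : τ → Val := fun p => .cons (repMatrix (D (φ p)) (m (φ p)) (K (φ p)) p.mat)
    (.cons (encUnary p.r) (encUnary p.b))
  let X : τ → Val := fun p => .cons (x (φ p)) (w p)
  have hM : MatParams (fun p => s (φ p)) X (fun p => D (φ p)) (fun p => m (φ p))
      (fun p => K (φ p)) (fun p => p.mat) := { h.up φ w with matrix := fst (snd id) }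
  have cr : Cmp (fun p => s (φ p)) X (fun p => encUnary p.r) := fst (snd (snd id))
  have cb : Cmp (fun p => s (φ p)) X (fun p => encUnary p.b) := snd (snd (snd id))
  have hK4 : PolyBounded (fun i => K i ^ 4) s := h.size_le.pow 4
  have br : PolyBounded (fun p : τ => p.r) (fun p => s (φ p)) := (hK4.comp φ).mono fun p => p.r_le
  have br' : PolyBounded (fun p : τ => p.r - 1) (fun p => s (φ p)) := br.mono fun p => Nat.sub_le _ _
  have q1 := quad_fst hM.size hM.size_le (pred cr) br'
  have q2 := quad_snd hM.size hM.size_le (pred cr) br'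
  have q3 := quad_thd hM.size hM.size_le (pred cr) br'
  have q4 := quad_fth hM.size hM.size_le (pred cr) br'
  have b1 : PolyBounded (fun p : τ => (quad (K (φ p)) (p.r - 1)).1) (fun p => s (φ p)) :=
    br'.mono fun p => (quad_le _ _).1
  have b2 : PolyBounded (fun p : τ => (quad (K (φ p)) (p.r - 1)).2.1) (fun p => s (φ p)) :=
    br'.mono fun p => (quad_le _ _).2.1
  have b3 : PolyBounded (fun p : τ => (quad (K (φ p)) (p.r - 1)).2.2.1) (fun p => s (φ p)) :=
    br'.mono fun p => (quad_le _ _).2.2.1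
  have b4 : PolyBounded (fun p : τ => (quad (K (φ p)) (p.r - 1)).2.2.2) (fun p => s (φ p)) :=
    br'.mono fun p => (quad_le _ _).2.2.2
  have hF := ((hM.force q2 b2 q4 b4).force q1 b1 q3 b3).matrix
  have hinc : Cmp (fun p => s (φ p)) X
      (fun p => encBool (decide (Increasing (quad (K (φ p)) (p.r - 1))))) :=
    and (lt q1 q2 b2) (and (lt q2 q3 b3) (lt q3 q4 b4))
  let c₁ : τ → τ := fun p => ⟨p.base, p.mat, p.r - 1, p.b, (Nat.sub_le _ _).trans p.r_le, p.b_le⟩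
  let c₂ : τ → τ := fun p => ⟨p.base, forceQuad (quad (K p.base) (p.r - 1)) p.mat, p.r - 1, p.b - 1,
    (Nat.sub_le _ _).trans p.r_le, (Nat.sub_le _ _).trans p.b_le⟩
  let Y : τ → Val := fun p => rep (D (φ p)) (m (φ p)) (hafnianApprox (K (φ p)) p.r p.b p.mat)
  have key : Cmp (fun p => s (φ p)) X Y := by
    -- At most `(r + 1) ^ b` leaves, since `r ^ b + r ^ (b - 1) ≤ (r + 1) ^ b` for `b ≥ 1`; a binary
    -- tree has one inner node fewer than leaves.
    refine tree (leaf := fun p => p.b = 0 ∨ p.r = 0) (φ := c₁) (ψ := c₂)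
      (cnt := fun p => 2 * (p.r + 1) ^ p.b - 1) (or (eq_zero cb) (eq_zero cr)) ?_ ?_ ?_ ?_
      (fun p _ => le_rfl) (fun p _ => le_rfl) ?_ ?_ ?_
    · have h1 := ite (eq_zero cb) (rep_zero hM.toParams)
        (rep_pfaffian hM (hn.up φ w) fun p => hK (φ p))
      refine (h1.reindex fun p : {p : τ // p.b = 0 ∨ p.r = 0} => p.1).congr ?_
      rintro ⟨⟨i, B, r, b, hr, hb⟩, hp⟩
      simp only [Y, φ] at hp ⊢
      rcases r with _ | r
      · rw [hafnianApprox]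
        split_ifs <;> rfl
      · have hb : b = 0 := by omega
        rw [hafnianApprox, if_pos hb, if_pos hb]
    · exact ((fst id).cons ((fst (snd id)).cons ((pred cr).cons cb))).reindex _
    · exact ((fst id).cons (hF.cons ((pred cr).cons (pred cb)))).reindex _
    · let μ : {p : τ // ¬ (p.b = 0 ∨ p.r = 0)} → τ := Subtype.val
      let v : {p : τ // ¬ (p.b = 0 ∨ p.r = 0)} → Val := fun p => .cons (Y (c₁ p)) (Y (c₂ p))
      have hP := (hM.toParams.reindex μ).up _root_.id v
      have y1 : Cmp (fun p => s (φ (μ p))) (fun p => .cons (X (μ p)) (v p))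
          (fun p => Y (c₁ (μ p))) := fst (snd id)
      have y2 : Cmp (fun p => s (φ (μ p))) (fun p => .cons (X (μ p)) (v p))
          (fun p => Y (c₂ (μ p))) := snd (snd id)
      -- The second child is evaluated at every inner node and discarded if the quadruple is not
      -- increasing, which the node count allows for.
      have h1 : Cmp (fun p => s (φ (μ p))) (fun p => .cons (X (μ p)) (v p))
          (fun p => rep (D (φ (μ p))) (m (φ (μ p)))
            (if Increasing (quad (K (φ (μ p))) ((μ p).r - 1)) then
              hafnianApprox (K (φ (μ p))) ((μ p).r - 1) ((μ p).b - 1)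
                (forceQuad (quad (K (φ (μ p))) ((μ p).r - 1)) (μ p).mat) else 0)) :=
        (ite (hinc.up μ v) y2 (rep_zero hP)).congr fun p => by split_ifs <;> rfl
      refine (rep_sub (a := fun p => hafnianApprox (K (φ (μ p))) ((μ p).r - 1) (μ p).b (μ p).mat)
        hP y1 (rep_add hP h1 h1)).congr ?_
      rintro ⟨⟨i, B, r, b, hr, hb⟩, hp⟩
      simp only [Y, φ, μ] at hp ⊢
      rcases r with _ | r
      · omega
      · rw [hafnianApprox_succ (by omega), two_mul]
        rfl
    · rintro ⟨i, B, r, b, hr, hb⟩ hp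
      simp only [c₁, c₂] at hp ⊢
      rcases r with _ | r
      · omega
      rcases b with _ | b
      · omega
      have h1 : 1 ≤ (r + 1) ^ b := Nat.one_le_pow _ _ (by omega)
      have h2 : (r + 1) ^ b ≤ (r + 2) ^ b := Nat.pow_le_pow_left (by omega) _
      have h3 : (r + 1) ^ (b + 1) + (r + 1) ^ b ≤ (r + 1 + 1) ^ (b + 1) := by
        calc (r + 1) ^ (b + 1) + (r + 1) ^ b = (r + 1) ^ b * (r + 2) := by ring
          _ ≤ (r + 2) ^ b * (r + 2) := Nat.mul_le_mul_right _ h2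
          _ = (r + 1 + 1) ^ (b + 1) := by ring
      have h4 : 1 ≤ (r + 1) ^ (b + 1) := Nat.one_le_pow _ _ (by omega)
      simp only [Nat.add_sub_cancel]
      omega
    · intro p
      have h1 : 1 ≤ (p.r + 1) ^ p.b := Nat.one_le_pow _ _ (by omega)
      omega
    · refine (((PolyBounded.const 2).mul hb).comp φ).mono fun p => ?_
      refine (Nat.sub_le _ _).trans (Nat.mul_le_mul_left _ ?_)
      exact (Nat.pow_le_pow_left (Nat.succ_le_succ p.r_le) _).trans
        (Nat.pow_le_pow_right (by omega) p.b_le)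
  have cK2 := mul h.size h.size_le h.size h.size_le
  have bK2 := h.size_le.mul h.size_le
  have cK4 : Cmp s x (fun i => encUnary (K i ^ 4)) :=
    (mul cK2 bK2 cK2 bK2).congr fun i => by congr 1; ring
  have hX : Cmp s x (fun i => X ⟨i, A i, K i ^ 4, k i, le_rfl, le_rfl⟩) :=
    id.cons (h.matrix.cons (cK4.cons hk))
  exact hX.comp (key.reindex fun i => ⟨i, A i, K i ^ 4, k i, le_rfl, le_rfl⟩)

end Cmp

end Lisp

/-! ### Reading the input and writing the output -/

namespace Lisp

open Polynomial Haf

/-- An instance of the problem. -/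
structure Instance where
  /-- half the size of the matrix -/
  n : ℕ
  /-- the bound for the degrees -/
  N : ℕ
  /-- the precision -/
  k : ℕ
  one_le : 1 ≤ k
  /-- the matrix -/
  A : Matrix (Fin (2 * n)) (Fin (2 * n)) ℤ[X]
  mem : A ∈ polyMatrices n N

namespace Instance

/-- A polynomial bound for the parameters of an instance other than the precision. -/
def base (i : Instance) : ℕ := (2 * i.n) ^ 4 + i.n * i.N + 2 * i.n + i.N + 2

/-- The measure of the size of an instance. -/
def size (i : Instance) : ℕ := i.base ^ i.k

theorem two_le_base (i : Instance) : 2 ≤ i.base := Nat.le_add_left _ _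

theorem base_le_size (i : Instance) : i.base ≤ i.size :=
  Nat.le_self_pow (by have := i.one_le; omega) _

theorem two_pow_le_size (i : Instance) : 2 ^ i.k ≤ i.size :=
  Nat.pow_le_pow_left i.two_le_base _

/-- The input that encodes an instance. -/
noncomputable def input (i : Instance) : Val := encInput i.n i.N i.k i.A

/-- The matrix of an instance, extended by zero. -/
noncomputable def entries (i : Instance) (u v : ℕ) : ℤ[X] :=
  if h : u < 2 * i.n ∧ v < 2 * i.n then i.A ⟨u, h.1⟩ ⟨v, h.2⟩ else 0

end Instance

open Instance

theorem getD_ofFn {K j : ℕ} (f : Fin K → Val) (h : j < K) : (List.ofFn f).getD j .nil = f ⟨j, h⟩ := by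
  simp [List.getD_eq_getElem?_getD, h]

theorem matParams_input : MatParams size input (fun i => i.n * i.N + 1) (fun i => 2 ^ i.k)
    (fun i => 2 * i.n) entries := by
  have cn : Cmp size input (fun i => encUnary i.n) := .fst .id
  have cN : Cmp size input (fun i => encUnary i.N) := .fst (.snd .id)
  have ck : Cmp size input (fun i => encUnary i.k) := .fst (.snd (.snd .id))
  have cA : Cmp size input (fun i => encMatrix i.N i.A) := .snd (.snd (.snd .id))
  have bbase : PolyBounded Instance.base size := .of_le base_le_size
  have bn : PolyBounded n size := bbase.mono fun i => by rw [Instance.base]; omega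
  have bN : PolyBounded N size := bbase.mono fun i => by rw [Instance.base]; omega
  have bD : PolyBounded (fun i : Instance => i.n * i.N + 1) size :=
    bbase.mono fun i => by rw [Instance.base]; omega
  have bK : PolyBounded (fun i : Instance => 2 * i.n) size :=
    bbase.mono fun i => by rw [Instance.base]; omega
  have bm : PolyBounded (fun i : Instance => 2 ^ i.k) size := .of_le two_pow_le_size
  have cK : Cmp size input (fun i => encUnary (2 * i.n)) := .mul (.unary 2) (.const 2) cn bn
  have hP : Params size input (fun i => i.n * i.N + 1) (fun i => 2 ^ i.k) :=
    ⟨(Cmp.mul cn bn cN bN).succ, bD, Cmp.two_pow ck bm, bm, fun i => by positivity⟩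
  refine ⟨hP, cK, bK, ?_⟩
  let ψ : (Σ i : Instance, Fin (2 * i.n)) → Instance := Sigma.fst
  let φ : (Σ p : (Σ i : Instance, Fin (2 * i.n)), Fin (2 * p.1.n)) →
    (Σ i : Instance, Fin (2 * i.n)) := Sigma.fst
  let x : (Σ p : (Σ i : Instance, Fin (2 * i.n)), Fin (2 * p.1.n)) → Val := fun p =>
    .cons (.cons (input (ψ (φ p))) (encUnary (φ p).2)) (encUnary p.2)
  have hP' : Params (fun p => size (ψ (φ p))) x _ _ := (hP.up ψ fun p => encUnary p.2).up φ _
  have cN' : Cmp (fun p => size (ψ (φ p))) x (fun p => encUnary (ψ (φ p)).N) :=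
    (cN.up ψ fun p => encUnary p.2).up φ _
  have ck' : Cmp (fun p => size (ψ (φ p))) x (fun p => encUnary (ψ (φ p)).k) :=
    (ck.up ψ fun p => encUnary p.2).up φ _
  have cA' : Cmp (fun p => size (ψ (φ p))) x (fun p => encMatrix (ψ (φ p)).N (ψ (φ p)).A) :=
    (cA.up ψ fun p => encUnary p.2).up φ _
  have cu : Cmp (fun p => size (ψ (φ p))) x (fun p => encUnary p.1.2) := .snd (.fst .id)
  have cv : Cmp (fun p => size (ψ (φ p))) x (fun p => encUnary p.2) := .last
  have bK' := (bK.comp ψ).comp φ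
  have cE : Cmp (fun p => size (ψ (φ p))) x
      (fun p => encPoly (ψ (φ p)).N ((ψ (φ p)).A p.1.2 p.2)) := by
    have h1 := Cmp.getD cA' cu (bK'.mono fun p => p.1.2.2.le)
    have h2 : Cmp (fun p => size (ψ (φ p))) x (fun p => encList (List.ofFn fun j =>
        encPoly (ψ (φ p)).N ((ψ (φ p)).A p.1.2 j))) :=
      h1.congr fun p => getD_ofFn _ p.1.2.2
    exact (Cmp.getD h2 cv (bK'.mono fun p => p.2.2.le)).congr fun p => getD_ofFn _ p.2.2
  refine Cmp.repMatrix_of_entry cK bK (Cmp.congr (y := fun p =>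
    rep ((ψ (φ p)).n * (ψ (φ p)).N + 1) (2 ^ (ψ (φ p)).k) ((ψ (φ p)).A p.1.2 p.2))
    (Cmp.rep_of_coeff hP' (f := fun p j => res (2 ^ (ψ (φ p)).k)
      (((ψ (φ p)).A p.1.2 p.2).coeff j)) ?_ fun p j _ => rfl) fun p => ?_)
  · let μ : (Σ p : (Σ p : (Σ i : Instance, Fin (2 * i.n)), Fin (2 * p.1.n)),
      Fin ((ψ (φ p)).n * (ψ (φ p)).N + 1)) → _ := Sigma.fst
    have bj : PolyBounded (fun p : (Σ p : (Σ p : (Σ i : Instance, Fin (2 * i.n)),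
      Fin (2 * p.1.n)), Fin ((ψ (φ p)).n * (ψ (φ p)).N + 1)) => (p.2 : ℕ))
      (fun p => size (ψ (φ (μ p)))) := (((bD.comp ψ).comp φ).comp μ).mono fun p => p.2.2.le
    have bN' := (((bN.add (.const 1)).comp ψ).comp φ).comp μ
    have cN'' := (cN'.up μ fun p => encUnary p.2).succ
    have cj : Cmp (fun p => size (ψ (φ (μ p)))) (fun p => .cons (x (μ p)) (encUnary p.2))
      (fun p => encUnary p.2) := .last
    -- The input lists degrees up to `N`, while the representation has `n * N + 1` entries. The
    -- missing ones are filled with `encInt 0`, as the list default `nil` does not encode an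
    -- integer.
    have hz := Cmp.ite (Cmp.lt cj cN'' bN') (Cmp.getD (cE.up μ fun p => encUnary p.2) cj bj)
      (Cmp.const (encInt 0))
    refine Cmp.unary_of_int (z := fun p => ((ψ (φ (μ p))).A p.1.1.2 p.1.2).coeff p.2)
      (hz.congr fun p => ?_) (ck'.up μ _) (((bm.comp ψ).comp φ).comp μ)
    split_ifs with h
    · rw [List.getD_eq_getElem?_getD, List.getElem?_map, List.getElem?_range h]
      rfl
    · rw [coeff_eq_zero_of_natDegree_lt]
      exact ((ψ (φ (μ p))).mem.2.2 _ _).trans_lt (by omega)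
  · rw [entries, dif_pos ⟨p.1.2.2, p.2.2⟩]

theorem coeff_hafnian_modEq (i : Instance) (j : ℕ) :
    (hafnianApprox (2 * i.n) ((2 * i.n) ^ 4) i.k i.entries).coeff j ≡ (hafnian i.A).coeff j
      [ZMOD ((2 ^ i.k : ℕ) : ℤ)] := by
  have h := two_pow_dvd_sub_hafnianApprox (le_refl ((2 * i.n) ^ 4)) i.k i.entries
  rw [partialHafnian_pow, hafnianOn_eq_hafnian i.A i.entries fun u v => by
    rw [entries, dif_pos ⟨u.2, v.2⟩]] at h
  obtain ⟨q, hq⟩ := h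
  have h5 := congr_arg (fun r : ℤ[X] => r.coeff j) hq
  have h6 : (2 : ℤ[X]) ^ i.k = C (((2 ^ i.k : ℕ) : ℤ)) := by simp
  simp only [h6, coeff_sub, coeff_C_mul] at h5
  exact Int.modEq_iff_dvd.2 ⟨_, h5⟩

theorem cmp_hafnian : Cmp size input
    (fun i => encPolyMod (2 ^ i.k) (i.n * i.N) (hafnian i.A)) := by
  have hM := matParams_input
  have cn : Cmp size input (fun i => encUnary i.n) := .fst .id
  have ck : Cmp size input (fun i => encUnary i.k) := .fst (.snd (.snd .id))
  have bm : PolyBounded (fun i : Instance => 2 ^ i.k) size := .of_le two_pow_le_size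
  have bcnt : PolyBounded (fun i : Instance => ((2 * i.n) ^ 4 + 1) ^ i.k) size :=
    .of_le fun i => Nat.pow_le_pow_left (by
      rw [Instance.base]
      omega) _
  have h1 := Cmp.rep_hafnianApprox hM cn (fun _ => rfl) ck bcnt
  let φ : (Σ i : Instance, Fin (i.n * i.N + 1)) → Instance := Sigma.fst
  have cj : Cmp (fun p => size (φ p)) (fun p => .cons (input (φ p)) (encUnary p.2))
    (fun p => encUnary p.2) := .last
  have h2 := Cmp.coeff (hM.toParams.up φ fun p => encUnary p.2) (h1.up φ fun p => encUnary p.2)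
    cj fun p => p.2.2
  have h3 := Cmp.nat_of_unary h2 ((bm.comp φ).mono fun p => (res_lt (by positivity) _).le)
  have h4 : ∀ p : Σ i : Instance, Fin (i.n * i.N + 1), encNat (res (2 ^ (φ p).k)
      ((hafnianApprox (2 * (φ p).n) ((2 * (φ p).n) ^ 4) (φ p).k (φ p).entries).coeff p.2)) =
      encNat ((hafnian (φ p).A).coeff p.2 % ((2 ^ (φ p).k : ℕ) : ℤ)).toNat := fun p => by
    rw [res, coeff_hafnian_modEq (φ p) p.2]
  have h5 := h3.congr h4
  let v : Instance → ℕ → Val := fun i j =>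
    encNat ((hafnian i.A).coeff j % ((2 ^ i.k : ℕ) : ℤ)).toNat
  have h6 : Cmp (fun p => size (φ p)) (fun p => .cons (input (φ p)) (encUnary p.2))
    (fun p => v (φ p) p.2) := h5
  have h7 := Cmp.tabulate hM.deg hM.deg_le h6
  refine h7.congr fun i => ?_
  rw [encPolyMod]

end Lisp

theorem theorem3 :
    ∃ (f : MvPolynomial (Fin 2) ℕ) (P : Lisp.Program) (C : ℕ),
      ∀ (k : ℕ), 1 ≤ k → ∀ (n N : ℕ),
        ∀ A : Matrix (Fin (2 * n)) (Fin (2 * n)) (Polynomial ℤ), A ∈ Haf.polyMatrices n N →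
          ∃ t : ℕ, t ≤ C * (MvPolynomial.eval ![n, N] f) ^ k ∧
            Lisp.Halts P (Lisp.encInput n N k A)
              (Lisp.encPolyMod (2 ^ k) (n * N) (Haf.hafnian A)) t := by
  obtain ⟨P, e, T, hT, h⟩ := Lisp.cmp_hafnian
  obtain ⟨c, hc⟩ := hT.add (.const 3)
  let g : MvPolynomial (Fin 2) ℕ := (2 * .X 0) ^ 4 + .X 0 * .X 1 + 2 * .X 0 + .X 1 + 2
  -- Function `0` must be the main function, so a single call is put in front of the program. The
  -- factor `(c + 1) ^ c` comes from `size + c ≤ (c + 1) * size`, valid as `size ≥ 1`; then `(base ^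
  -- k) ^ c = (base ^ c) ^ k`.
  refine ⟨g ^ c, [Lisp.Expr.call (1 + e) (.var 0)] ++ P.map (Lisp.Expr.shift 1), (c + 1) ^ c,
    fun k hk n N A hA => ?_⟩
  let i : Lisp.Instance := ⟨n, N, k, hk, A, hA⟩
  obtain ⟨t, ht, h⟩ := h i
  have hg : MvPolynomial.eval ![n, N] g = i.base := by
    simp [g, Lisp.Instance.base, i]
  refine ⟨1 + t + 1, ?_, _, rfl, (h.prepend [Lisp.Expr.call (1 + e) (.var 0)]).call (.var rfl)⟩
  have hs : 1 ≤ i.size := Nat.one_le_pow _ _ (by have := i.two_le_base; omega)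
  calc 1 + t + 1 ≤ T i + 3 := by omega
    _ ≤ (i.size + c) ^ c := hc i
    _ ≤ ((c + 1) * i.size) ^ c := Nat.pow_le_pow_left (by nlinarith) _
    _ = (c + 1) ^ c * (MvPolynomial.eval ![n, N] (g ^ c)) ^ k := by
      rw [mul_pow, map_pow, hg, Lisp.Instance.size, ← pow_mul, ← pow_mul, mul_comm c]
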